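/- For a positive integer $n$ and finite simple graphs $T$ and $H$, let $\mathrm{ex}(n,T,H)$ denote the maximum number of copies of $T$ (subgraphs isomorphic to $T$, not necessarily induced) in a simple graph on $n$ vertices that contains no subgraph isomorphic to $H$. Let $C_\ell$ denote the cycle of length $\ell$. Then for every odd integer $k \ge 7$, $$\mathrm{ex}(n, C_k, C_{k-2}) = \left(\frac{n}{k}\right)^k + o(n^k) \qquad (n \to \infty,\ k \text{ fixed}).$$ -/

import Mathlib

open scoped Classical in
/-- The generalized Turán number `ex(n, T, H)`: the maximum number of (unlabelled, not necessarily
induced) copies of `T` in an `H`-free simple graph on `n` vertices. If there is no `H`-free simple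
graph on `n` vertices, then this is `0`. -/
noncomputable def SimpleGraph.generalizedTuranNumber (n : ℕ) {U : Type*} (T : SimpleGraph U)
    {W : Type*} (H : SimpleGraph W) : ℕ :=
  Finset.sup {G : SimpleGraph (Fin n) | H.Free G} (fun G => G.copyCount T)

/-! Lower bound: in the blow-up of `C_k` by residues mod `k`, the residue map is a homomorphism to
`C_k`. A shorter odd cycle admits no such homomorphism, so the blow-up is `C_{k-2}`-free, and its
transversal cycles alone number at least `⌊n/k⌋ ^ k`.

Upper bound: in a `C_{k-2}`-free graph every closed walk of length `k - 2` repeats a vertex, so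
there are only `O(n ^ (k-3))` of them. A Cauchy–Schwarz argument (`trace_adjMatrix_pow_four_le`)
replaces three-step walks by five-step walks; hence sparse closed walks of length `l + 2` force
sparse ones of length `l`, and all odd lengths from `3` to `k - 2` are sparse
(`exists_trace_adjMatrix_pow_le`).

It remains to show that there are at most `2k (n/k) ^ k + o(n ^ k)` homomorphisms from `C_k`, since
each copy yields `2k` of them. Up to `o(n ^ k)` they are good: no chord spans three edges, and
vertices at distance two have linear codegree. Choose the vertices of a good homomorphism one at a
time, each uniformly from a candidate set fixed by the earlier choices. The probabilities sum to at
most one (`Finset.sum_prod_sequential_le_one`). Comparing the candidate sets with their sizes in the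
balanced blow-up, and linearising by `1 + y ≤ exp y`, reduces the bound to an upper estimate for
their average normalised sizes.

By the dihedral symmetry of the good homomorphisms, this average is a sum over vertices `z` of a
weight depending only on which cycle indices are adjacent to `z`, or have large codegree with it.
The weight is at most `2k - 2` unless `z` closes a short odd walk with the cycle
(`cycleWeight_le_of_sparse`). The exceptional pairs are rare by sparsity, and
`card_goodCycleHoms_le` combines these facts. -/

section

open Finset

/-! ### Walk counts and sums over cyclic sequences -/

/-- Sum over all sequences of a product of matrix entries along consecutive terms. -/
theorem Matrix.sum_prod_consecutive_eq_sum_pow {V : Type*} [Fintype V] [DecidableEq V]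
    (B : Matrix V V ℝ) (d : ℕ) (F : V → V → ℝ) :
    ∑ f : Fin (d + 1) → V, (∏ t : Fin d, B (f t.castSucc) (f t.succ)) * F (f 0) (f (Fin.last d))
      = ∑ u, ∑ v, (B ^ d) u v * F u v := by
  induction d generalizing F with
  | zero =>
    rw [← (Equiv.funUnique (Fin 1) V).symm.sum_comp]
    simp [Matrix.one_apply]
  | succ d ih =>
    rw [← (Fin.snocEquiv (fun _ : Fin (d + 2) => V)).sum_comp, Fintype.sum_prod_type_right]
    have h : ∀ g : Fin (d + 1) → V, ∑ x : V,
        (∏ t : Fin (d + 1), B ((Fin.snocEquiv (fun _ : Fin (d + 2) => V)) (x, g) t.castSucc)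
          ((Fin.snocEquiv (fun _ : Fin (d + 2) => V)) (x, g) t.succ)) *
          F ((Fin.snocEquiv (fun _ : Fin (d + 2) => V)) (x, g) 0)
            ((Fin.snocEquiv (fun _ : Fin (d + 2) => V)) (x, g) (Fin.last (d + 1)))
        = (∏ t : Fin d, B (g t.castSucc) (g t.succ)) *
            (fun a b => ∑ x, B b x * F a x) (g 0) (g (Fin.last d)) := by
      intro g
      rw [Finset.mul_sum]
      refine Finset.sum_congr rfl fun x _ => ?_
      rw [Fin.prod_univ_castSucc]
      have h0 : (Fin.snoc g x : Fin (d + 2) → V) 0 = g 0 := by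
        rw [← Fin.castSucc_zero, Fin.snoc_castSucc]
      simp only [Fin.snocEquiv, Equiv.coe_fn_mk]
      simp only [Fin.snoc_castSucc, Fin.succ_last, Fin.snoc_last, Fin.succ_castSucc, h0]
      ring
    rw [Finset.sum_congr rfl fun g _ => h g]
    refine (ih fun a b => ∑ x, B b x * F a x).trans ?_
    refine Finset.sum_congr rfl fun u _ => ?_
    simp only [pow_succ, Matrix.mul_apply, Finset.mul_sum, Finset.sum_mul]
    rw [Finset.sum_comm]
    refine Finset.sum_congr rfl fun v _ => Finset.sum_congr rfl fun w _ => ?_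
    ring

/-- Summing a function of the first coordinates over all sequences. -/
theorem Fin.sum_comp_castAdd {V : Type*} [Fintype V] (m r : ℕ) (F : (Fin m → V) → ℝ) :
    ∑ f : Fin (m + r) → V, F (fun i => f (Fin.castAdd r i))
      = (Fintype.card V : ℝ) ^ r * ∑ g : Fin m → V, F g := by
  classical
  rw [← (Fin.appendEquiv m r).sum_comp, Fintype.sum_prod_type_right]
  simp [Fin.appendEquiv, Fintype.card_pi]

/-- Casting identifies functions on `ZMod k` with functions on `Fin k`. -/
theorem ZMod.sum_comp_natCast {V : Type*} [Fintype V] (k : ℕ) [NeZero k]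
    (F : (Fin k → V) → ℝ) :
    ∑ f : ZMod k → V, F (fun i => f ((i : ℕ) : ZMod k)) = ∑ g : Fin k → V, F g := by
  have hb : Function.Bijective (fun i : Fin k => ((i : ℕ) : ZMod k)) := by
    rw [Fintype.bijective_iff_injective_and_card]
    refine ⟨fun i j h => ?_, by simp⟩
    have := (ZMod.natCast_eq_natCast_iff' _ _ _).1 h
    rw [Nat.mod_eq_of_lt i.2, Nat.mod_eq_of_lt j.2] at this
    exact Fin.ext this
  exact Fintype.sum_equiv ((Equiv.ofBijective _ hb).symm.arrowCongr (Equiv.refl V)) _ _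
    fun f => rfl

namespace SimpleGraph
variable {V : Type*} [Fintype V]

/-- Homomorphisms from the cycle `ZMod k` to `G`. -/
def cycleHoms (G : SimpleGraph V) [DecidableRel G.Adj] (k : ℕ) [NeZero k] :
    Finset (ZMod k → V) :=
  {f | ∀ i, G.Adj (f i) (f (i + 1))}

theorem mem_cycleHoms {G : SimpleGraph V} [DecidableRel G.Adj] {k : ℕ} [NeZero k]
    {f : ZMod k → V} : f ∈ G.cycleHoms k ↔ ∀ i, G.Adj (f i) (f (i + 1)) := by
  simp [cycleHoms]

theorem cycleHoms_comp_add {G : SimpleGraph V} [DecidableRel G.Adj] {k : ℕ} [NeZero k]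
    (c : ZMod k) {f : ZMod k → V} (hf : f ∈ G.cycleHoms k) :
    (fun i => f (i + c)) ∈ G.cycleHoms k := by
  rw [mem_cycleHoms] at *
  intro i
  have := hf (i + c)
  rwa [add_right_comm] at this

/-- A family of maps closed under a bijective reindexing can be summed after reindexing. -/
theorem _root_.Finset.sum_comp_equiv_of_mem {ι W : Type*} (s : Finset (ι → W)) (e : ι ≃ ι)
    (h : ∀ f ∈ s, f ∘ e ∈ s) (h' : ∀ f ∈ s, f ∘ e.symm ∈ s) (F : (ι → W) → ℝ) :
    ∑ f ∈ s, F (f ∘ e) = ∑ f ∈ s, F f :=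
  Finset.sum_bij' (fun f _ => f ∘ e) (fun f _ => f ∘ e.symm) h h'
    (fun f _ => by ext; simp) (fun f _ => by ext; simp) (fun f _ => rfl)

/-- Counting homomorphisms of the cycle weighted by a pair of their values. -/
theorem sum_cycleHoms_le [DecidableEq V] (G : SimpleGraph V) [DecidableRel G.Adj] {k : ℕ} [NeZero k]
    {d : ℕ} (hd : d + 1 ≤ k) (i : ZMod k) (M : V → V → ℝ) (hM : ∀ u v, 0 ≤ M u v) :
    ∑ f ∈ G.cycleHoms k, M (f i) (f (i + d))
      ≤ (Fintype.card V : ℝ) ^ (k - d - 1) * ∑ u, ∑ v, (G.adjMatrix ℝ ^ d) u v * M u v := by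
  have h1 : ∑ f ∈ G.cycleHoms k, M (f i) (f (i + d))
      = ∑ f ∈ G.cycleHoms k, M (f 0) (f d) := by
    rw [← Finset.sum_comp_equiv_of_mem (G.cycleHoms k) (Equiv.addRight i)
      (fun f hf => cycleHoms_comp_add i hf)
      (fun f hf => by simpa [Function.comp_def] using cycleHoms_comp_add (-i) hf)
      (fun f => M (f 0) (f d))]
    simp [add_comm]
  rw [h1]
  obtain ⟨r, rfl⟩ := Nat.exists_eq_add_of_le hd
  rw [show d + 1 + r - d - 1 = r by omega, ← Matrix.sum_prod_consecutive_eq_sum_pow,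
    ← Fin.sum_comp_castAdd, ← ZMod.sum_comp_natCast (d + 1 + r)]
  have h2 : ∀ f : ZMod (d + 1 + r) → V, 0 ≤ (∏ t : Fin d, G.adjMatrix ℝ
        (f ((t : ℕ) : ZMod (d + 1 + r))) (f (((t : ℕ) : ZMod (d + 1 + r)) + 1)))
          * M (f 0) (f d) := by
    intro f
    refine mul_nonneg (Finset.prod_nonneg fun t _ => ?_) (hM _ _)
    rw [adjMatrix_apply]; split_ifs <;> norm_num
  -- The `d` edges from `0` to `d` are kept as matrix entries and the other edges of the cycle are
  -- forgotten, which frees the remaining `k - d - 1` vertices.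
  calc ∑ f ∈ G.cycleHoms (d + 1 + r), M (f 0) (f d)
      = ∑ f ∈ G.cycleHoms (d + 1 + r), (∏ t : Fin d, G.adjMatrix ℝ
        (f ((t : ℕ) : ZMod (d + 1 + r))) (f (((t : ℕ) : ZMod (d + 1 + r)) + 1)))
          * M (f 0) (f d) := by
        refine Finset.sum_congr rfl fun f hf => ?_
        rw [mem_cycleHoms] at hf
        rw [Finset.prod_eq_one, one_mul]
        intro t _
        rw [adjMatrix_apply, if_pos (hf _)]
    _ ≤ ∑ f : ZMod (d + 1 + r) → V, (∏ t : Fin d, G.adjMatrix ℝ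
        (f ((t : ℕ) : ZMod (d + 1 + r))) (f (((t : ℕ) : ZMod (d + 1 + r)) + 1)))
          * M (f 0) (f d) :=
        Finset.sum_le_sum_of_subset_of_nonneg (Finset.subset_univ _) fun f _ _ => h2 f
    _ = _ := by
        refine Finset.sum_congr rfl fun f _ => ?_
        simp
end SimpleGraph

/-! ### Closed walks of odd length: sparsity passes to shorter lengths -/

/-- Four-cycle counting: the lower bound for a `0`-`1` valued function of two variables. -/
theorem Finset.sum_pow_four_le_card_pow_mul {V : Type*} [Fintype V] (f : V → V → ℝ) :
    (∑ a, ∑ b, f a b) ^ 4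
      ≤ (Fintype.card V : ℝ) ^ 4 * ∑ a, ∑ a', (∑ b, f a b * f a' b) ^ 2 := by
  -- Cauchy–Schwarz twice: over `b` here, then over the pairs `(a, a')`.
  have h1 : (∑ a, ∑ b, f a b) ^ 2 ≤ (Fintype.card V : ℝ) * ∑ a, ∑ a', ∑ b, f a b * f a' b := by
    rw [Finset.sum_comm]
    refine sq_sum_le_card_mul_sum_sq.trans_eq ?_
    congr 1
    simp_rw [sq, Finset.sum_mul_sum]
    rw [Finset.sum_comm]
    exact Finset.sum_congr rfl fun a _ => Finset.sum_comm
  have h2 : (∑ a, ∑ a', ∑ b, f a b * f a' b) ^ 2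
      ≤ (Fintype.card V : ℝ) ^ 2 * ∑ a, ∑ a', (∑ b, f a b * f a' b) ^ 2 := by
    have := sq_sum_le_card_mul_sum_sq (s := (Finset.univ : Finset (V × V)))
      (f := fun x => ∑ b, f x.1 b * f x.2 b)
    simpa [Fintype.sum_prod_type, sq] using this
  calc (∑ a, ∑ b, f a b) ^ 4 = ((∑ a, ∑ b, f a b) ^ 2) ^ 2 := by ring
    _ ≤ ((Fintype.card V : ℝ) * ∑ a, ∑ a', ∑ b, f a b * f a' b) ^ 2 := by gcongr
    _ = (Fintype.card V : ℝ) ^ 2 * (∑ a, ∑ a', ∑ b, f a b * f a' b) ^ 2 := by ring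
    _ ≤ (Fintype.card V : ℝ) ^ 2 *
          ((Fintype.card V : ℝ) ^ 2 * ∑ a, ∑ a', (∑ b, f a b * f a' b) ^ 2) := by gcongr
    _ = _ := by ring

/-- Weighted power mean inequality with exponent four. -/
theorem Finset.sum_mul_pow_four_le {ι : Type*} (s : Finset ι) (w x : ι → ℝ)
    (hw : ∀ i ∈ s, 0 ≤ w i) :
    (∑ i ∈ s, w i * x i) ^ 4 ≤ (∑ i ∈ s, w i) ^ 3 * ∑ i ∈ s, w i * x i ^ 4 := by
  have h : ∀ y : ι → ℝ, (∑ i ∈ s, w i * y i) ^ 2 ≤ (∑ i ∈ s, w i) * ∑ i ∈ s, w i * y i ^ 2 :=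
    fun y => sum_sq_le_sum_mul_sum_of_sq_le_mul s hw
      (fun i hi => mul_nonneg (hw i hi) (sq_nonneg _)) (fun i _ => le_of_eq (by ring))
  have hW : 0 ≤ ∑ i ∈ s, w i := Finset.sum_nonneg hw
  calc (∑ i ∈ s, w i * x i) ^ 4 = ((∑ i ∈ s, w i * x i) ^ 2) ^ 2 := by ring
    _ ≤ ((∑ i ∈ s, w i) * ∑ i ∈ s, w i * x i ^ 2) ^ 2 :=
        pow_le_pow_left₀ (sq_nonneg _) (h x) 2
    _ = (∑ i ∈ s, w i) ^ 2 * (∑ i ∈ s, w i * x i ^ 2) ^ 2 := by ring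
    _ ≤ (∑ i ∈ s, w i) ^ 2 * ((∑ i ∈ s, w i) * ∑ i ∈ s, w i * (x i ^ 2) ^ 2) := by
        gcongr; exact h _
    _ = _ := by
        simp_rw [← pow_mul]; ring

namespace SimpleGraph
variable {V : Type*} (G : SimpleGraph V) [DecidableRel G.Adj]

theorem adjMatrix_nonneg (u v : V) : 0 ≤ G.adjMatrix ℝ u v := by
  rw [adjMatrix_apply]; split_ifs <;> norm_num

theorem adjMatrix_le_one (u v : V) : G.adjMatrix ℝ u v ≤ 1 := by
  rw [adjMatrix_apply]; split_ifs <;> norm_num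

theorem adjMatrix_comm (u v : V) : G.adjMatrix ℝ u v = G.adjMatrix ℝ v u := by
  simp only [adjMatrix_apply, G.adj_comm]

variable [Fintype V] [DecidableEq V]

theorem adjMatrix_pow_nonneg (d : ℕ) (u v : V) : 0 ≤ (G.adjMatrix ℝ ^ d) u v := by
  rw [adjMatrix_pow_apply_eq_card_walk]; positivity

theorem adjMatrix_pow_comm (d : ℕ) (u v : V) :
    (G.adjMatrix ℝ ^ d) u v = (G.adjMatrix ℝ ^ d) v u := by
  conv_lhs => rw [← transpose_adjMatrix, ← Matrix.transpose_pow, Matrix.transpose_apply]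

/-- The number of closed walks splits at any intermediate time. -/
theorem trace_adjMatrix_pow_add (a b : ℕ) :
    ∑ u, ∑ v, (G.adjMatrix ℝ ^ a) u v * (G.adjMatrix ℝ ^ b) u v
      = (G.adjMatrix ℝ ^ (a + b)).trace := by
  rw [pow_add, Matrix.trace]
  refine Finset.sum_congr rfl fun u _ => ?_
  rw [Matrix.diag_apply, Matrix.mul_apply]
  exact Finset.sum_congr rfl fun v _ => by rw [G.adjMatrix_pow_comm b u v]

theorem sum_adjMatrix_pow_le (d : ℕ) :
    ∑ u, ∑ v, (G.adjMatrix ℝ ^ d) u v ≤ (Fintype.card V : ℝ) ^ (d + 1) := by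
  have h := Matrix.sum_prod_consecutive_eq_sum_pow (G.adjMatrix ℝ) d (fun _ _ => 1)
  simp only [mul_one] at h
  rw [← h]
  refine (Finset.sum_le_card_nsmul _ _ 1 fun f _ => ?_).trans_eq (by simp)
  exact Finset.prod_le_one (fun _ _ => G.adjMatrix_nonneg _ _) (fun _ _ => G.adjMatrix_le_one _ _)

/-- Walks of length five are at least as many as predicted by those of length three. -/
theorem adjMatrix_pow_three_pow_four_le (q p : V) :
    (G.adjMatrix ℝ ^ 3) q p ^ 4 ≤ (Fintype.card V : ℝ) ^ 4 * (G.adjMatrix ℝ ^ 5) q p := by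
  set A := G.adjMatrix ℝ with hA
  have h0 : ∀ u v, 0 ≤ A u v := G.adjMatrix_nonneg
  have h1 : ∀ u v, A u v ≤ 1 := G.adjMatrix_le_one
  have e3 : (A ^ 3) q p = ∑ a, ∑ b, A q a * A a b * A b p := by
    rw [show A ^ 3 = A * (A * A) by rw [pow_succ, pow_two, mul_assoc]]
    simp only [Matrix.mul_apply, Finset.mul_sum, mul_assoc]
  have e5 : (A ^ 5) q p = ∑ a, ∑ a', ∑ b, ∑ b', A q a * A a b * A b a' * A a' b' * A b' p := by
    rw [show A ^ 5 = A * (A * (A * (A * A))) by simp only [pow_succ, pow_zero, one_mul, mul_assoc]]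
    simp only [Matrix.mul_apply, Finset.mul_sum, mul_assoc]
    exact Finset.sum_congr rfl fun a _ => Finset.sum_comm
  rw [e3, e5]
  -- A four-cycle `a b a' b'` with `a, a'` adjacent to `q` and `b, b'` adjacent to `p` contains the
  -- walk `q a b a' b' p`. The seven unused adjacency factors are at most one and are dropped.
  refine (Finset.sum_pow_four_le_card_pow_mul fun a b => A q a * A a b * A b p).trans ?_
  gcongr with a _ a' _
  rw [sq, Finset.sum_mul_sum]
  refine Finset.sum_le_sum fun b _ => Finset.sum_le_sum fun b' _ => ?_
  have c : A a' b = A b a' := G.adjMatrix_comm _ _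
  have hx : A q a * A a b * A b p * (A q a' * A a' b * A b p) *
      (A q a * A a b' * A b' p * (A q a' * A a' b' * A b' p))
      = (A q a * A a b * A b a' * A a' b' * A b' p) *
        (A b p * (A q a' * (A b p * (A q a * (A a b' * (A b' p * A q a')))))) := by
    rw [c]; ring
  rw [hx]
  refine mul_le_of_le_one_right ?_ ?_
  · have := h0 q a; have := h0 a b; have := h0 b a'; have := h0 a' b'; have := h0 b' p
    positivity
  · have key : ∀ x y : ℝ, 0 ≤ x → x ≤ 1 → (0 ≤ y ∧ y ≤ 1) → (0 ≤ x * y ∧ x * y ≤ 1) :=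
      fun x y hx0 hx1 hy => ⟨mul_nonneg hx0 hy.1, mul_le_one₀ hx1 hy.1 hy.2⟩
    refine (key _ _ (h0 _ _) (h1 _ _) (key _ _ (h0 _ _) (h1 _ _) (key _ _ (h0 _ _) (h1 _ _)
      (key _ _ (h0 _ _) (h1 _ _) (key _ _ (h0 _ _) (h1 _ _) (key _ _ (h0 _ _) (h1 _ _)
      ⟨h0 _ _, h1 _ _⟩)))))).2

/-- If closed walks of length `l` are dense then so are closed walks of length `l + 2`. -/
theorem trace_adjMatrix_pow_four_le (d : ℕ) :
    (G.adjMatrix ℝ ^ (d + 3)).trace ^ 4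
      ≤ (Fintype.card V : ℝ) ^ (3 * d + 7) * (G.adjMatrix ℝ ^ (d + 5)).trace := by
  rw [← trace_adjMatrix_pow_add, ← trace_adjMatrix_pow_add, ← Fintype.sum_prod_type',
    ← Fintype.sum_prod_type']
  -- A closed walk is cut into parts of lengths `d` and `3`. The first part serves as the weight of
  -- a power mean, and only the second is lengthened to five.
  refine (Finset.sum_mul_pow_four_le Finset.univ
    (fun x : V × V => (G.adjMatrix ℝ ^ d) x.1 x.2)
    (fun x => (G.adjMatrix ℝ ^ 3) x.1 x.2) fun x _ => G.adjMatrix_pow_nonneg _ _ _).trans ?_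
  have hW : ∑ x : V × V, (G.adjMatrix ℝ ^ d) x.1 x.2 ≤ (Fintype.card V : ℝ) ^ (d + 1) := by
    rw [Fintype.sum_prod_type]; exact G.sum_adjMatrix_pow_le d
  calc (∑ x : V × V, (G.adjMatrix ℝ ^ d) x.1 x.2) ^ 3 *
        ∑ x : V × V, (G.adjMatrix ℝ ^ d) x.1 x.2 * (G.adjMatrix ℝ ^ 3) x.1 x.2 ^ 4
      ≤ ((Fintype.card V : ℝ) ^ (d + 1)) ^ 3 *
        ∑ x : V × V, (G.adjMatrix ℝ ^ d) x.1 x.2 *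
          ((Fintype.card V : ℝ) ^ 4 * (G.adjMatrix ℝ ^ 5) x.1 x.2) := by
        have : ∀ x : V × V, 0 ≤ (G.adjMatrix ℝ ^ d) x.1 x.2 :=
          fun x => G.adjMatrix_pow_nonneg _ _ _
        refine mul_le_mul (pow_le_pow_left₀ (Finset.sum_nonneg fun x _ => this x) hW 3)
          (Finset.sum_le_sum fun x _ => mul_le_mul_of_nonneg_left
            (G.adjMatrix_pow_three_pow_four_le _ _) (this x))
          (Finset.sum_nonneg fun x _ => mul_nonneg (this x) (by positivity)) (by positivity)
    _ = _ := by
        have : ∀ x : V × V, (G.adjMatrix ℝ ^ d) x.1 x.2 *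
          ((Fintype.card V : ℝ) ^ 4 * (G.adjMatrix ℝ ^ 5) x.1 x.2)
            = (Fintype.card V : ℝ) ^ 4 * ((G.adjMatrix ℝ ^ d) x.1 x.2 *
              (G.adjMatrix ℝ ^ 5) x.1 x.2) := fun x => by ring
        rw [Finset.sum_congr rfl fun x _ => this x, ← Finset.mul_sum]
        ring

/-- If closed walks of odd length `2 * s + 3` are sparse, then so are those of smaller odd
length. -/
theorem exists_trace_adjMatrix_pow_le (s : ℕ) {ε : ℝ} (hε : 0 < ε) :
    ∃ η > 0, ∀ (V : Type) [Fintype V] [DecidableEq V] (G : SimpleGraph V) [DecidableRel G.Adj],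
      (G.adjMatrix ℝ ^ (2 * s + 3)).trace ≤ η * (Fintype.card V : ℝ) ^ (2 * s + 3) →
      ∀ r ≤ s, (G.adjMatrix ℝ ^ (2 * r + 3)).trace ≤ ε * (Fintype.card V : ℝ) ^ (2 * r + 3) := by
  induction s with
  | zero => exact ⟨ε, hε, fun V _ _ G _ h r hr => by obtain rfl : r = 0 := by omega
                                                     exact h⟩
  | succ s ih =>
    obtain ⟨η, hη, H⟩ := ih
    -- The fourth power undoes the loss in `trace_adjMatrix_pow_four_le`: `(6s + 7) + (2s + 5) =
    -- 4(2s + 3)`.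
    refine ⟨min ε (η ^ 4), by positivity, fun V _ _ G _ h r hr => ?_⟩
    rcases Nat.lt_or_ge s r with hr' | hr'
    · obtain rfl : r = s + 1 := by omega
      exact h.trans (by gcongr; exact min_le_left _ _)
    · refine H V G ?_ r hr'
      refine le_of_pow_le_pow_left₀ (n := 4) (by norm_num) (by positivity) ?_
      refine (G.trace_adjMatrix_pow_four_le (2 * s)).trans ?_
      calc (Fintype.card V : ℝ) ^ (3 * (2 * s) + 7) * (G.adjMatrix ℝ ^ (2 * s + 5)).trace
          ≤ (Fintype.card V : ℝ) ^ (3 * (2 * s) + 7) *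
            (η ^ 4 * (Fintype.card V : ℝ) ^ (2 * (s + 1) + 3)) := by
            gcongr
            exact h.trans (by gcongr; exact min_le_right _ _)
        _ = _ := by ring

/-- A closed sequence of adjacent vertices is a homomorphism of the cycle graph. -/
def cycleGraphHom {W : Type*} {G : SimpleGraph W} {m : ℕ} (f : Fin (m + 1) → W)
    (h : ∀ i, G.Adj (f i) (f (i + 1))) : cycleGraph (m + 1) →g G where
  toFun := f
  map_rel' := by
    intro a b hab
    rw [cycleGraph_eq_circulantGraph, circulantGraph_adj] at hab
    rcases hab.2 with hab | hab
    · rw [Set.mem_singleton_iff, sub_eq_iff_eq_add'] at hab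
      rw [hab]
      exact (h b).symm
    · rw [Set.mem_singleton_iff, sub_eq_iff_eq_add'] at hab
      rw [hab]
      exact h a

/-- The number of maps identifying two given points. -/
theorem _root_.Fin.card_filter_apply_eq_le {m : ℕ} {i j : Fin (m + 1)} (hij : i ≠ j) :
    #{f : Fin (m + 1) → V | f i = f j} ≤ Fintype.card V ^ m := by
  have : Fintype.card V ^ m = #(Finset.univ : Finset (Fin m → V)) := by simp
  rw [this]
  refine Finset.card_le_card_of_injOn (fun f => f ∘ j.succAbove) (fun _ _ => by simp) ?_
  intro f hf g hg hfg
  simp only [Finset.coe_filter, Finset.mem_univ, true_and, Set.mem_ofPred_eq] at hf hg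
  have H : ∀ l, l ≠ j → f l = g l := by
    intro l hl
    obtain ⟨t, rfl⟩ := Fin.exists_succAbove_eq hl
    exact congrFun hfg t
  funext l
  by_cases hl : l = j
  · rw [hl, ← hf, ← hg, H i hij]
  · exact H l hl

/-- A cycle-free graph has few closed walks of the length of the cycle. -/
theorem trace_adjMatrix_pow_le_of_free {m : ℕ} (h : (cycleGraph (m + 1)).Free G) :
    (G.adjMatrix ℝ ^ (m + 1)).trace ≤ (m + 1 : ℝ) ^ 2 * (Fintype.card V : ℝ) ^ m := by
  rw [← trace_adjMatrix_pow_add, pow_one]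
  refine (Matrix.sum_prod_consecutive_eq_sum_pow (G.adjMatrix ℝ) m
    fun u v => G.adjMatrix ℝ u v).symm.trans_le ?_
  -- An injective closed walk would be a copy of the forbidden cycle, so every closed walk
  -- identifies two indices; a union bound over pairs of indices follows.
  calc ∑ f : Fin (m + 1) → V, (∏ t : Fin m, G.adjMatrix ℝ (f t.castSucc) (f t.succ)) *
        G.adjMatrix ℝ (f 0) (f (Fin.last m))
      ≤ ∑ f : Fin (m + 1) → V, ∑ p ∈ (Finset.univ : Finset (Fin (m + 1))).offDiag,
          if f p.1 = f p.2 then (1 : ℝ) else 0 := by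
        refine Finset.sum_le_sum fun f _ => ?_
        have hpos : 0 ≤ ∑ p ∈ (Finset.univ : Finset (Fin (m + 1))).offDiag,
          if f p.1 = f p.2 then (1 : ℝ) else 0 :=
          Finset.sum_nonneg fun p _ => by split_ifs <;> norm_num
        have hone : (∏ t : Fin m, G.adjMatrix ℝ (f t.castSucc) (f t.succ)) *
            G.adjMatrix ℝ (f 0) (f (Fin.last m)) ≤ 1 :=
          mul_le_one₀ (Finset.prod_le_one (fun _ _ => G.adjMatrix_nonneg _ _)
            (fun _ _ => G.adjMatrix_le_one _ _)) (G.adjMatrix_nonneg _ _) (G.adjMatrix_le_one _ _)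
        by_cases hf : Function.Injective f
        · refine le_of_eq_of_le ?_ hpos
          by_contra hne
          rw [mul_eq_zero, not_or] at hne
          have hne' := Finset.prod_ne_zero_iff.1 hne.1
          refine h ⟨⟨cycleGraphHom f fun i => ?_, hf⟩⟩
          induction i using Fin.lastCases with
          | last =>
            have := hne.2
            rw [adjMatrix_apply] at this
            rw [Fin.last_add_one]
            exact (by simpa using this : G.Adj _ _).symm
          | cast t =>
            have := hne' t (Finset.mem_univ _)
            rw [adjMatrix_apply] at this
            rw [Fin.coeSucc_eq_succ]
            simpa using this
        · obtain ⟨i, j, hij, hne⟩ : ∃ i j, f i = f j ∧ i ≠ j := by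
            simpa [Function.Injective] using hf
          refine hone.trans ?_
          have := Finset.single_le_sum (f := fun p : Fin (m + 1) × Fin (m + 1) =>
            if f p.1 = f p.2 then (1 : ℝ) else 0)
            (s := (Finset.univ : Finset (Fin (m + 1))).offDiag)
            (fun p _ => by split_ifs <;> norm_num) (a := (i, j)) (by simpa using hne)
          simpa [hij] using this
    _ = ∑ p ∈ (Finset.univ : Finset (Fin (m + 1))).offDiag,
          (#{f : Fin (m + 1) → V | f p.1 = f p.2} : ℝ) := by
        rw [Finset.sum_comm]; simp
    _ ≤ ∑ p ∈ (Finset.univ : Finset (Fin (m + 1))).offDiag, (Fintype.card V : ℝ) ^ m := by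
        refine Finset.sum_le_sum fun p hp => ?_
        exact_mod_cast Fin.card_filter_apply_eq_le (by simpa using hp)
    _ ≤ _ := by
        rw [Finset.sum_const, nsmul_eq_mul]
        gcongr
        rw [Finset.offDiag_card]
        simp only [Finset.card_univ, Fintype.card_fin]
        have : (m + 1) * (m + 1) - (m + 1) ≤ (m + 1) ^ 2 := by rw [sq]; omega
        exact_mod_cast this
end SimpleGraph

/-! ### The sequential choice inequality -/

/-- Averaging over one coordinate. -/
theorem Finset.sum_sum_update {ι V : Type*} [Fintype ι] [DecidableEq ι] [Fintype V]
    (a : ι) (F : (ι → V) → ℝ) :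
    ∑ u : ι → V, ∑ x, F (Function.update u a x) = (Fintype.card V : ℝ) * ∑ u, F u := by
  classical
  have hinv : Function.Involutive
      (fun y : (ι → V) × V => (Function.update y.1 a y.2, y.1 a)) := by
    rintro ⟨u, x⟩
    simp
  rw [← Fintype.sum_prod_type']
  rw [Fintype.sum_equiv hinv.toPerm (fun y : (ι → V) × V => F (Function.update y.1 a y.2))
    (fun y => F y.1) fun y => rfl, Fintype.sum_prod_type]
  simp [Finset.mul_sum]

/-- If the coordinates of a vector are chosen one after the other, in the order of `r`, each
uniformly from a set determined by the previous choices, then the total probability is at most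
one. -/
theorem Finset.sum_prod_sequential_le_one {ι V : Type*} [Fintype ι] [DecidableEq ι] [Fintype V]
    [DecidableEq V] [Nonempty V] (r : ι → ℕ) (hr : Function.Injective r)
    (S : ι → (ι → V) → Finset V)
    (hS : ∀ j u u', (∀ i, r i < r j → u i = u' i) → S j u = S j u') :
    ∑ u : ι → V, ∏ j, (if u j ∈ S j u then (#(S j u) : ℝ)⁻¹ else 0) ≤ 1 := by
  set w : ι → (ι → V) → ℝ := fun j u => if u j ∈ S j u then (#(S j u) : ℝ)⁻¹ else 0 with hw
  have hw0 : ∀ j u, 0 ≤ w j u := fun j u => by simp only [hw]; split_ifs <;> positivity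
  have hn : (0 : ℝ) < Fintype.card V := by exact_mod_cast Fintype.card_pos
  -- Induction on `s`, adding an index `a` of largest rank: resampling coordinate `a` leaves the
  -- other factors and the set `S a` unchanged, and the factor of `a` then sums to at most one.
  have key : ∀ s : Finset ι, (Fintype.card V : ℝ) ^ #s * ∑ u : ι → V, ∏ j ∈ s, w j u
      ≤ (Fintype.card V : ℝ) ^ Fintype.card ι := by
    intro s
    induction s using Finset.induction_on_max_value r with
    | empty => simp
    | insert a s ha hmax ih =>
      refine le_trans ?_ ih
      rw [Finset.card_insert_of_notMem ha, pow_succ, mul_assoc]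
      refine mul_le_mul_of_nonneg_left ?_ (by positivity)
      rw [← Finset.sum_sum_update a]
      refine Finset.sum_le_sum fun u _ => ?_
      have hlt : ∀ j ∈ s, r j < r a := fun j hj =>
        lt_of_le_of_ne (hmax j hj) fun h => ha (hr h ▸ hj)
      have hind : ∀ j ∈ s, ∀ x, w j (Function.update u a x) = w j u := by
        intro j hj x
        have hja : j ≠ a := fun h => ha (h ▸ hj)
        have : S j (Function.update u a x) = S j u := hS _ _ _ fun i hi =>
          Function.update_of_ne (fun h => by subst h; exact absurd (hlt j hj) (by omega)) _ _
        simp only [hw, this, Function.update_of_ne hja]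
      have hSa : ∀ x, S a (Function.update u a x) = S a u := fun x => hS _ _ _ fun i hi =>
        Function.update_of_ne (fun h => by subst h; omega) _ _
      have hx : ∀ x, ∏ j ∈ insert a s, w j (Function.update u a x)
          = (if x ∈ S a u then (#(S a u) : ℝ)⁻¹ else 0) * ∏ j ∈ s, w j u := by
        intro x
        rw [Finset.prod_insert ha, Finset.prod_congr rfl fun j hj => hind j hj x]
        simp only [hw, hSa, Function.update_self]
      rw [Finset.sum_congr rfl fun x _ => hx x, ← Finset.sum_mul]
      refine mul_le_of_le_one_left (Finset.prod_nonneg fun j _ => hw0 _ _) ?_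
      rw [← Finset.sum_filter, Finset.sum_const, nsmul_eq_mul]
      simp only [Finset.filter_univ_mem]
      exact mul_inv_le_one
  have := key Finset.univ
  rw [Finset.card_univ] at this
  exact le_of_mul_le_mul_left (by simpa using this) (pow_pos hn (Fintype.card ι))

/-- The sum over `insert` of a nonnegative function. -/
theorem Finset.sum_insert_le_add {ι : Type*} [DecidableEq ι] {t : ι → ℝ} (ht : ∀ i, 0 ≤ t i)
    (a : ι) (s : Finset ι) : ∑ i ∈ insert a s, t i ≤ t a + ∑ i ∈ s, t i := by
  by_cases h : a ∈ s
  · rw [Finset.insert_eq_of_mem h]; linarith [ht a]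
  · rw [Finset.sum_insert h]

/-! ### The weight of a vertex relative to a cycle -/

/-- The weight with which a vertex adjacent to the cycle exactly at `P`, and joined by many paths of
length two to the cycle at `S`, is counted in the candidate sets of a sequential choice of the
cycle. -/
noncomputable def cycleWeight {k : ℕ} [NeZero k] (P S : Finset (ZMod k)) : ℝ :=
  -- With `D`, `Q`, `X` as in `sum_card_cycleCandidates`, these coefficients come from `D + 4Q + 2X
  -- + 2(k - 5)(D - Q)`; the two halves of `2X` use the two orientations of the cycle.
  ∑ i, ((2 * k - 9) * (if i ∈ P then 1 else 0)
    - (2 * k - 14) * (if i ∈ P ∧ i + 2 ∈ P then 1 else 0)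
    + (if i ∈ S then 2 - (if i - 1 ∈ P then 1 else 0) - (if i + 1 ∈ P then 1 else 0) else 0))

/-- The crude bound charged to exceptional vertices. Since `2k - 14 ≥ 0`, each summand is at most
`(2k - 9) + 2`. -/
theorem cycleWeight_le {k : ℕ} [NeZero k] (hk7 : 7 ≤ k) (P S : Finset (ZMod k)) :
    cycleWeight P S ≤ 2 * (k : ℝ) ^ 2 := by
  have h7 : (7 : ℝ) ≤ k := by exact_mod_cast hk7
  calc cycleWeight P S ≤ ∑ i : ZMod k, (2 * k : ℝ) :=
        Finset.sum_le_sum fun i _ => by split_ifs <;> linarith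
    _ = _ := by simp [ZMod.card]; ring

/-- The weight of a vertex compatible with the absence of short odd closed walks. -/
theorem cycleWeight_le_of_sparse {k : ℕ} [NeZero k] (hk : Odd k) (hk7 : 7 ≤ k)
    {P S : Finset (ZMod k)}
    (hP : ∀ i ∈ P, ∀ d : ℕ, Odd d → d + 4 ≤ k → i + d ∉ P)
    (hPS : ∀ i ∈ P, ∀ d : ℕ, Even d → d + 5 ≤ k → i + d ∉ S)
    (hSP : ∀ i ∈ S, ∀ d : ℕ, Even d → d + 5 ≤ k → i + d ∉ P)
    (hS : ¬ (0 ∈ S ∧ 1 ∈ S)) :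
    cycleWeight P S ≤ 2 * k - 2 := by
  have h7 : (7 : ℝ) ≤ k := by exact_mod_cast hk7
  have hval : ∀ x : ZMod k, ((x.val : ℕ) : ZMod k) = x := fun x => ZMod.natCast_zmod_val x
  have hkk : (k : ZMod k) = 0 := ZMod.natCast_self k
  have hnat : ∀ m : ℕ, 0 < m → m < k → (m : ZMod k) ≠ 0 := fun m h0 hm h => by
    rw [ZMod.natCast_eq_zero_iff] at h
    exact absurd (Nat.le_of_dvd h0 h) (by omega)
  -- Since `k` is odd, exactly one of the two arcs between `a` and `b` has odd length, and that
  -- length must exceed `k - 4`.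
  have hPP : ∀ a ∈ P, ∀ b ∈ P, b = a ∨ b = a + 2 ∨ b = a - 2 := by
    intro a ha b hb
    have hlt := ZMod.val_lt (b - a)
    have hb' : b = a + ((b - a).val : ℕ) := by rw [hval]; ring
    generalize (b - a).val = t at hlt hb'
    rcases Nat.even_or_odd t with ht | ht
    · have h := hP b hb (k - t)
      have h2 : b + ((k - t : ℕ) : ZMod k) = a := by
        rw [Nat.cast_sub hlt.le, hkk, hb']; ring
      rw [h2] at h
      have h3 : Odd (k - t) := Nat.Odd.sub_even hlt.le hk ht
      have h4 : ¬ (k - t + 4 ≤ k) := fun h5 => h h3 h5 ha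
      have h5 : t = 0 ∨ t = 2 := by obtain ⟨c, rfl⟩ := ht; omega
      rcases h5 with rfl | rfl
      · left; simpa using hb'
      · right; left; simpa using hb'
    · have h := hP a ha t ht
      rw [← hb'] at h
      have h4 : ¬ (t + 4 ≤ k) := fun h5 => h h5 hb
      have h5 : t + 2 = k := by obtain ⟨c, rfl⟩ := ht; obtain ⟨e, rfl⟩ := hk; omega
      right; right
      have h6 : ((t + 2 : ℕ) : ZMod k) = 0 := by rw [h5, hkk]
      push_cast at h6
      rw [hb']; linear_combination h6
  -- Here the even arc must be longer than `k - 5`.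
  have hSS : ∀ a ∈ P, ∀ b ∈ S, b = a - 3 ∨ b = a - 1 ∨ b = a + 1 ∨ b = a + 3 := by
    intro a ha b hb
    have hlt := ZMod.val_lt (b - a)
    have hb' : b = a + ((b - a).val : ℕ) := by rw [hval]; ring
    generalize (b - a).val = t at hlt hb'
    rcases Nat.even_or_odd t with ht | ht
    · have h := hPS a ha t ht
      rw [← hb'] at h
      have h4 : ¬ (t + 5 ≤ k) := fun h5 => h h5 hb
      have h5 : t + 3 = k ∨ t + 1 = k := by obtain ⟨c, rfl⟩ := ht; obtain ⟨e, rfl⟩ := hk; omega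
      rcases h5 with h5 | h5
      · have h6 : ((t + 3 : ℕ) : ZMod k) = 0 := by rw [h5, hkk]
        push_cast at h6
        left; rw [hb']; linear_combination h6
      · have h6 : ((t + 1 : ℕ) : ZMod k) = 0 := by rw [h5, hkk]
        push_cast at h6
        right; left; rw [hb']; linear_combination h6
    · have h := hSP b hb (k - t)
      have h2 : b + ((k - t : ℕ) : ZMod k) = a := by
        rw [Nat.cast_sub hlt.le, hkk, hb']; ring
      rw [h2] at h
      have h3 : Even (k - t) := Nat.Odd.sub_odd hk ht
      have h4 : ¬ (k - t + 5 ≤ k) := fun h5 => h h3 h5 ha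
      have h5 : t = 1 ∨ t = 3 := by obtain ⟨c, rfl⟩ := ht; omega
      rcases h5 with rfl | rfl
      · right; right; left; simpa using hb'
      · right; right; right; simpa using hb'
  set t : ZMod k → ℝ :=
    fun i => 2 - (if i - 1 ∈ P then 1 else 0) - (if i + 1 ∈ P then 1 else 0) with ht
  have ht0 : ∀ i, 0 ≤ t i := fun i => by simp only [ht]; split_ifs <;> norm_num
  have ht2 : ∀ i, t i ≤ 2 := fun i => by simp only [ht]; split_ifs <;> norm_num
  have hW : cycleWeight P S = (2 * k - 9) * #P
      - (2 * k - 14) * (∑ i, (if i ∈ P ∧ i + 2 ∈ P then (1 : ℝ) else 0)) + ∑ i ∈ S, t i := by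
    have hS' : ∑ i ∈ S, t i = ∑ i, if i ∈ S then t i else 0 := by simp
    rw [hS']
    simp only [cycleWeight, Finset.sum_add_distrib, Finset.sum_sub_distrib, ← Finset.mul_sum]
    congr 3
    simp
  have hQ : 0 ≤ ∑ i, (if i ∈ P ∧ i + 2 ∈ P then (1 : ℝ) else 0) :=
    Finset.sum_nonneg fun i _ => by split_ifs <;> norm_num
  -- The configuration of the blow-up, where the bound is sharp: `2(2k - 9) - (2k - 14) + 2 = 2k -
  -- 2`.
  have hpair : ∀ a ∈ P, a + 2 ∈ P → cycleWeight P S ≤ 2 * k - 2 := by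
    intro a ha ha2
    have hsub : P ⊆ {a, a + 2} := by
      intro b hb
      rcases hPP a ha b hb with h | h | h
      · simp [h]
      · simp [h]
      · exfalso
        have := hPP _ ha2 b hb
        rw [h] at this
        rcases this with h | h | h
        · exact hnat 4 (by omega) (by omega) (by push_cast; linear_combination -h)
        · exact hnat 6 (by omega) (by omega) (by push_cast; linear_combination -h)
        · exact hnat 2 (by omega) (by omega) (by push_cast; linear_combination -h)
    have hPc : (#P : ℝ) ≤ 2 := by
      exact_mod_cast (Finset.card_le_card hsub).trans Finset.card_le_two
    have hQ1 : 1 ≤ ∑ i, (if i ∈ P ∧ i + 2 ∈ P then (1 : ℝ) else 0) := by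
      have := Finset.single_le_sum (f := fun i => if i ∈ P ∧ i + 2 ∈ P then (1 : ℝ) else 0)
        (s := Finset.univ) (fun i _ => by split_ifs <;> norm_num) (Finset.mem_univ a)
      simpa [ha, ha2] using this
    have hSsub : S ⊆ {a - 1, a + 1, a + 3} := by
      intro b hb
      rcases hSS a ha b hb with h | h | h | h
      · exfalso
        have := hSS _ ha2 b hb
        rw [h] at this
        rcases this with h | h | h | h
        · exact hnat 2 (by omega) (by omega) (by push_cast; linear_combination -h)
        · exact hnat 4 (by omega) (by omega) (by push_cast; linear_combination -h)
        · exact hnat 6 (by omega) (by omega) (by push_cast; linear_combination -h)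
        -- The coincidence `a - 3 = (a + 2) + 3` would need `k ∣ 8`, impossible for odd `k ≥ 7`.
        · have h8 : ((8 : ℕ) : ZMod k) = 0 := by push_cast; linear_combination -h
          rw [ZMod.natCast_eq_zero_iff] at h8
          have := Nat.le_of_dvd (by norm_num) h8
          interval_cases k
          · omega
          · exact absurd hk (by decide)
      all_goals simp [h]
    have hsum : ∑ i ∈ S, t i ≤ 2 := by
      have h1 : t (a - 1) ≤ 1 := by
        simp only [ht, sub_add_cancel, ha, if_true]; split_ifs <;> norm_num
      have h2 : t (a + 1) ≤ 0 := by
        simp [ht, add_assoc, one_add_one_eq_two, ha, ha2]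
      have h3 : t (a + 3) ≤ 1 := by
        have : a + 3 - 1 = a + 2 := by ring
        simp only [ht, this, ha2, if_true]; split_ifs <;> norm_num
      calc ∑ i ∈ S, t i ≤ ∑ i ∈ {a - 1, a + 1, a + 3}, t i :=
            Finset.sum_le_sum_of_subset_of_nonneg hSsub fun i _ _ => ht0 i
        _ ≤ t (a - 1) + (t (a + 1) + t (a + 3)) := by
            refine (Finset.sum_insert_le_add ht0 _ _).trans ?_
            gcongr
            refine (Finset.sum_insert_le_add ht0 _ _).trans ?_
            simp
        _ ≤ 2 := by linarith
    rw [hW]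
    nlinarith
  rcases P.eq_empty_or_nonempty with hP0 | ⟨a, ha⟩
  -- With `P` empty each index of `S` counts `2`, so one missing index suffices for `2(k - 1)`.
  · have hSc : #S + 1 ≤ k := by
      have : S ⊂ Finset.univ := by
        rw [Finset.ssubset_univ_iff]
        rintro rfl
        exact hS ⟨Finset.mem_univ _, Finset.mem_univ _⟩
      have := Finset.card_lt_card this
      rw [Finset.card_univ, ZMod.card] at this
      omega
    have hSc' : (#S : ℝ) + 1 ≤ k := by exact_mod_cast hSc
    have hsum : ∑ i ∈ S, t i ≤ #S * 2 := by
      simpa [nsmul_eq_mul] using Finset.sum_le_card_nsmul S t 2 fun i _ => ht2 i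
    rw [hW]
    have : (#P : ℝ) = 0 := by simp [hP0]
    rw [this]
    nlinarith
  · by_cases ha2 : a + 2 ∈ P
    · exact hpair a ha ha2
    by_cases ha3 : a - 2 ∈ P
    · exact hpair (a - 2) ha3 (by simpa using ha)
    have hsub : P ⊆ {a} := by
      intro b hb
      rcases hPP a ha b hb with h | h | h
      · simp [h]
      · exact absurd (h ▸ hb) ha2
      · exact absurd (h ▸ hb) ha3
    have hPc : (#P : ℝ) ≤ 1 := by
      exact_mod_cast (Finset.card_le_card hsub).trans_eq (Finset.card_singleton a)
    have hSsub : S ⊆ {a - 1, a + 1, a - 3, a + 3} := by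
      intro b hb
      rcases hSS a ha b hb with h | h | h | h <;> simp [h]
    -- With a single neighbour the total is at most `(2k - 9) + 6 = 2k - 3`.
    have hsum : ∑ i ∈ S, t i ≤ 6 := by
      have h1 : t (a - 1) ≤ 1 := by
        simp only [ht, sub_add_cancel, ha, if_true]; split_ifs <;> norm_num
      have h2 : t (a + 1) ≤ 1 := by
        simp only [ht, add_sub_cancel_right, ha, if_true]; split_ifs <;> norm_num
      calc ∑ i ∈ S, t i ≤ ∑ i ∈ {a - 1, a + 1, a - 3, a + 3}, t i :=
            Finset.sum_le_sum_of_subset_of_nonneg hSsub fun i _ _ => ht0 i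
        _ ≤ t (a - 1) + (t (a + 1) + (t (a - 3) + t (a + 3))) := by
            refine (Finset.sum_insert_le_add ht0 _ _).trans ?_
            gcongr
            refine (Finset.sum_insert_le_add ht0 _ _).trans ?_
            gcongr
            refine (Finset.sum_insert_le_add ht0 _ _).trans ?_
            simp
        _ ≤ 6 := by linarith [ht2 (a - 3), ht2 (a + 3)]
    rw [hW]
    nlinarith

/-! ### Distinguished residues modulo `k` -/

theorem ZMod.natCast_ne_natCast_of_lt {k a b : ℕ} (ha : a < k) (hb : b < k) (hab : a ≠ b) :
    (a : ZMod k) ≠ b := fun h => by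
  rw [ZMod.natCast_eq_natCast_iff', Nat.mod_eq_of_lt ha, Nat.mod_eq_of_lt hb] at h
  exact hab h

/-- The residues `0, 1, 2, 3, -1` are distinct modulo `k ≥ 5`. -/
theorem ZMod.small_residues_ne {k : ℕ} (hk : 5 ≤ k) :
    ((1 : ZMod k) ≠ 0 ∧ (2 : ZMod k) ≠ 0 ∧ (3 : ZMod k) ≠ 0 ∧ (-1 : ZMod k) ≠ 0) ∧
    ((2 : ZMod k) ≠ 1 ∧ (3 : ZMod k) ≠ 1 ∧ (-1 : ZMod k) ≠ 1) ∧
    ((3 : ZMod k) ≠ 2 ∧ (-1 : ZMod k) ≠ 2) ∧ (-1 : ZMod k) ≠ 3 := by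
  have h : ∀ a b : ℕ, a < k → b < k → a ≠ b → (a : ZMod k) ≠ b :=
    fun a b => ZMod.natCast_ne_natCast_of_lt
  have hm : ((k - 1 : ℕ) : ZMod k) = -1 := by
    rw [Nat.cast_sub (by omega), ZMod.natCast_self]; simp
  have h0 := fun b => h (k - 1) b (by omega)
  rw [hm] at h0
  refine ⟨⟨?_, ?_, ?_, ?_⟩, ⟨?_, ?_, ?_⟩, ⟨?_, ?_⟩, ?_⟩
  · exact_mod_cast h 1 0 (by omega) (by omega) (by omega)
  · exact_mod_cast h 2 0 (by omega) (by omega) (by omega)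
  · exact_mod_cast h 3 0 (by omega) (by omega) (by omega)
  · exact_mod_cast h0 0 (by omega) (by omega)
  · exact_mod_cast h 2 1 (by omega) (by omega) (by omega)
  · exact_mod_cast h 3 1 (by omega) (by omega) (by omega)
  · exact_mod_cast h0 1 (by omega) (by omega)
  · exact_mod_cast h 3 2 (by omega) (by omega) (by omega)
  · exact_mod_cast h0 2 (by omega) (by omega)
  · exact_mod_cast h0 3 (by omega) (by omega)

/-- Summing a function on `ZMod k` that is constant away from `0, 1, 2, 3, -1`. -/
theorem ZMod.sum_ite_small_residues {k : ℕ} [NeZero k] (hk : 5 ≤ k) (a b c d e x : ℝ) :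
    ∑ j : ZMod k, (if j = 0 then a else if j = 1 then b else if j = 2 then c else
      if j = 3 then d else if j = -1 then e else x) = a + b + c + d + e + (k - 5) * x := by
  obtain ⟨⟨h1, h2, h3, h4⟩, ⟨h5, h6, h7⟩, ⟨h8, h9⟩, h10⟩ := ZMod.small_residues_ne hk
  have : ∀ j : ZMod k, (if j = 0 then a else if j = 1 then b else if j = 2 then c else
      if j = 3 then d else if j = -1 then e else x) =
      x + (if j = 0 then a - x else 0) + (if j = 1 then b - x else 0) +
      (if j = 2 then c - x else 0) + (if j = 3 then d - x else 0) +
      (if j = -1 then e - x else 0) := by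
    intro j
    by_cases g0 : j = 0
    · subst g0; simp [h1.symm, h2.symm, h3.symm, h4.symm]
    by_cases g1 : j = 1
    · subst g1; simp [h1, h5.symm, h6.symm, h7.symm]
    by_cases g2 : j = 2
    · subst g2; simp [h2, h5, h8.symm, h9.symm]
    by_cases g3 : j = 3
    · subst g3; simp [h3, h6, h8, h10.symm]
    by_cases g4 : j = -1
    · subst g4; simp [h4, h7, h9, h10]
    simp [g0, g1, g2, g3, g4]
  rw [Finset.sum_congr rfl fun j _ => this j]
  simp only [Finset.sum_add_distrib, Finset.sum_ite_eq', Finset.mem_univ, if_true,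
    Finset.sum_const, Finset.card_univ, ZMod.card, nsmul_eq_mul]
  ring

/-! ### Good homomorphisms and their candidate sets -/

namespace SimpleGraph
variable {V : Type*} [Fintype V] [DecidableEq V] (G : SimpleGraph V) [DecidableRel G.Adj]

/-- Homomorphisms of the cycle without chords spanning three edges, in which vertices at distance
two have at least `τ` common neighbours. -/
noncomputable def goodCycleHoms (k : ℕ) [NeZero k] (τ : ℝ) : Finset (ZMod k → V) :=
  {f ∈ G.cycleHoms k |
    ∀ i, ¬ G.Adj (f i) (f (i + 3)) ∧ τ ≤ (G.adjMatrix ℝ ^ 2) (f i) (f (i + 2))}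

/-- The set of candidates for the image of `j` in the sequential choice of a homomorphism of the
cycle, in the order `0, 1, 3, 2, 4, 5, …`. -/
noncomputable def cycleCandidates {k : ℕ} (τ : ℝ) (j : ZMod k) (f : ZMod k → V) : Finset V :=
  if j = 0 then Finset.univ
  else if j = 1 then G.neighborFinset (f 0)
  else if j = 2 then G.neighborFinset (f 1) ∩ G.neighborFinset (f 3)
  -- Index `3` precedes `2`, so its set cannot refer to the image of `2`; large codegree with the
  -- image of `1` replaces adjacency. In the blow-up, avoiding the neighbours of `f 0` leaves a
  -- single class.
  else if j = 3 then Finset.univ.filter fun z => τ ≤ (G.adjMatrix ℝ ^ 2) z (f 1) ∧ ¬ G.Adj z (f 0)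
  else if j = -1 then G.neighborFinset (f (-2)) ∩ G.neighborFinset (f 0)
  else G.neighborFinset (f (j - 1)) \ G.neighborFinset (f (j - 3))

variable {G} {k : ℕ} [NeZero k] {τ : ℝ}

theorem mem_goodCycleHoms {f : ZMod k → V} : f ∈ G.goodCycleHoms k τ ↔
    (∀ i, G.Adj (f i) (f (i + 1))) ∧
    ∀ i, ¬ G.Adj (f i) (f (i + 3)) ∧ τ ≤ (G.adjMatrix ℝ ^ 2) (f i) (f (i + 2)) := by
  simp [goodCycleHoms, mem_cycleHoms]

theorem goodCycleHoms_comp_add (c : ZMod k) {f : ZMod k → V} (hf : f ∈ G.goodCycleHoms k τ) :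
    (fun i => f (i + c)) ∈ G.goodCycleHoms k τ := by
  rw [mem_goodCycleHoms] at *
  refine ⟨fun i => ?_, fun i => ?_⟩
  · rw [add_right_comm]; exact hf.1 _
  · rw [add_right_comm i 3, add_right_comm i 2]; exact hf.2 _

/-- Reflection symmetry; it allows the condition on `f (i - 1)` in the candidates for index `3` to
be traded for one on `f (i + 1)`. -/
theorem goodCycleHoms_comp_sub (c : ZMod k) {f : ZMod k → V} (hf : f ∈ G.goodCycleHoms k τ) :
    (fun i => f (c - i)) ∈ G.goodCycleHoms k τ := by
  rw [mem_goodCycleHoms] at *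
  refine ⟨fun i => ?_, fun i => ⟨?_, ?_⟩⟩
  · have := (hf.1 (c - (i + 1))).symm
    rwa [show c - (i + 1) + 1 = c - i by ring] at this
  · have := (hf.2 (c - (i + 3))).1
    rwa [show c - (i + 3) + 3 = c - i by ring, G.adj_comm] at this
  · have := (hf.2 (c - (i + 2))).2
    rwa [show c - (i + 2) + 2 = c - i by ring, G.adjMatrix_pow_comm] at this

theorem sum_goodCycleHoms_comp_add (c : ZMod k) (F : (ZMod k → V) → ℝ) :
    ∑ f ∈ G.goodCycleHoms k τ, F (fun i => f (i + c)) = ∑ f ∈ G.goodCycleHoms k τ, F f :=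
  Finset.sum_comp_equiv_of_mem _ (Equiv.addRight c) (fun _ hf => goodCycleHoms_comp_add c hf)
    (fun f hf => by
      simpa [Function.comp_def, sub_eq_add_neg] using goodCycleHoms_comp_add (-c) hf) F

theorem sum_goodCycleHoms_comp_sub (c : ZMod k) (F : (ZMod k → V) → ℝ) :
    ∑ f ∈ G.goodCycleHoms k τ, F (fun i => f (c - i)) = ∑ f ∈ G.goodCycleHoms k τ, F f :=
  Finset.sum_comp_equiv_of_mem _ (Equiv.subLeft c) (fun _ hf => goodCycleHoms_comp_sub c hf)
    (fun f hf => by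
      have := goodCycleHoms_comp_sub c hf
      convert this using 2
      simp [sub_eq_add_neg, add_comm]) F

theorem apply_mem_cycleCandidates {f : ZMod k → V} (hf : f ∈ G.goodCycleHoms k τ) (j : ZMod k) :
    f j ∈ G.cycleCandidates τ j f := by
  rw [mem_goodCycleHoms] at hf
  have h1 : ∀ i, G.Adj (f i) (f (i - 1)) := fun i => by
    simpa using (hf.1 (i - 1)).symm
  unfold cycleCandidates
  split_ifs with g0 g1 g2 g3 g4
  · simp
  · subst g1; simpa using hf.1 0
  · subst g2
    have e1 := hf.1 1
    have e2 := (hf.1 2).symm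
    norm_num at e1 e2
    simp [e1, e2]
  · subst g3
    have e1 := (hf.2 1).2
    have e2 := (hf.2 0).1
    norm_num at e1 e2
    rw [G.adj_comm] at e2
    rw [G.adjMatrix_pow_comm] at e1
    simp [e1, e2]
  · subst g4
    have e1 := hf.1 (-2)
    have e2 := (hf.1 (-1)).symm
    norm_num at e1 e2
    simp [e1, e2]
  · have e1 := hf.1 (j - 1)
    have e2 := (hf.2 (j - 3)).1
    rw [sub_add_cancel] at e1 e2
    simp [e1, e2]

/-- The order in which the images are chosen. -/
def cycleRank (j : ZMod k) : ℕ := if j.val = 2 then 3 else if j.val = 3 then 2 else j.val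

omit [NeZero k] in
theorem cycleRank_natCast {t : ℕ} (ht : t < k) :
    cycleRank (t : ZMod k) = if t = 2 then 3 else if t = 3 then 2 else t := by
  rw [cycleRank, ZMod.val_cast_of_lt ht]

theorem cycleRank_injective : Function.Injective (cycleRank (k := k)) := by
  intro i j h
  apply ZMod.val_injective
  unfold cycleRank at h
  split_ifs at h <;> omega

/-- Each candidate set consults only indices chosen earlier, as the sequential inequality requires.
For a generic index `t ≥ 4` these are `t - 1` and `t - 3`. -/
theorem cycleCandidates_congr (hk : 5 ≤ k) (j : ZMod k) (f f' : ZMod k → V)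
    (h : ∀ i, cycleRank i < cycleRank j → f i = f' i) :
    G.cycleCandidates τ j f = G.cycleCandidates τ j f' := by
  obtain ⟨t, ht, rfl⟩ : ∃ t : ℕ, t < k ∧ (t : ZMod k) = j :=
    ⟨j.val, ZMod.val_lt j, ZMod.natCast_zmod_val j⟩
  have h' : ∀ s : ℕ, s < k → (if s = 2 then 3 else if s = 3 then 2 else s) <
      (if t = 2 then 3 else if t = 3 then 2 else t) → f s = f' s := fun s hs hlt =>
    h _ (by rwa [cycleRank_natCast hs, cycleRank_natCast ht])
  have hc : ∀ s : ℕ, s < k → ((t : ZMod k) = s ↔ t = s) := fun s hs =>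
    ⟨fun e => by_contra fun hne => ZMod.natCast_ne_natCast_of_lt ht hs hne e, fun e => by rw [e]⟩
  have hneg : ∀ s : ℕ, s ≤ k → ((k - s : ℕ) : ZMod k) = -(s : ZMod k) := fun s hs => by
    rw [Nat.cast_sub hs, ZMod.natCast_self]; simp
  have c0 := hc 0 (by omega)
  have c1 := hc 1 (by omega)
  have c2 := hc 2 (by omega)
  have c3 := hc 3 (by omega)
  have c4 := hc (k - 1) (by omega)
  rw [hneg 1 (by omega)] at c4
  push_cast at c0 c1 c2 c3 c4
  unfold cycleCandidates
  split_ifs with g0 g1 g2 g3 g4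
  · rfl
  · rw [c1] at g1; subst g1
    have := h' 0 (by omega) (by simp)
    push_cast at this
    rw [this]
  · rw [c2] at g2; subst g2
    have e1 := h' 1 (by omega) (by simp)
    have e3 := h' 3 (by omega) (by simp)
    push_cast at e1 e3
    rw [e1, e3]
  · rw [c3] at g3; subst g3
    have e1 := h' 1 (by omega) (by simp)
    have e0 := h' 0 (by omega) (by simp)
    push_cast at e1 e0
    rw [e1, e0]
  · rw [c4] at g4; subst g4
    have e1 := h' (k - 2) (by omega) (by split_ifs <;> omega)
    have e0 := h' 0 (by omega) (by split_ifs with w1 w2 w3 w4 <;> omega)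
    rw [hneg 2 (by omega)] at e1
    push_cast at e1 e0
    rw [e1, e0]
  · rw [c0] at g0; rw [c1] at g1; rw [c2] at g2; rw [c3] at g3
    have e1 := h' (t - 1) (by omega) (by split_ifs <;> omega)
    have e3 := h' (t - 3) (by omega) (by split_ifs <;> omega)
    rw [Nat.cast_sub (by omega)] at e1 e3
    push_cast at e1 e3
    rw [e1, e3]

/-- The inequality extracted from the sequential choice of a good homomorphism. -/
theorem sum_goodCycleHoms_le_prod [Nonempty V] (hk : 5 ≤ k) (b : ZMod k → ℝ) (hb : ∀ j, 0 < b j) :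
    ∑ f ∈ G.goodCycleHoms k τ, (1 + ∑ j, (1 - #(G.cycleCandidates τ j f) / b j)) ≤ ∏ j, b j := by
  have hseq := Finset.sum_prod_sequential_le_one (V := V) (cycleRank (k := k)) cycleRank_injective
    (G.cycleCandidates τ) (cycleCandidates_congr hk)
  have hB : 0 < ∏ j, b j := Finset.prod_pos fun j _ => hb j
  -- With `x = |S_j| / b_j`, use `1 + y ≤ exp y` for the sum and `exp (1 - x) ≤ x⁻¹` for each
  -- factor; both are equalities when all `x = 1`.
  have hpt : ∀ f ∈ G.goodCycleHoms k τ, 1 + ∑ j, (1 - #(G.cycleCandidates τ j f) / b j) ≤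
      (∏ j, b j) * ∏ j, (if f j ∈ G.cycleCandidates τ j f then
        (#(G.cycleCandidates τ j f) : ℝ)⁻¹ else 0) := by
    intro f hf
    rw [← Finset.prod_mul_distrib]
    refine (add_comm (1 : ℝ) _).trans_le ((Real.add_one_le_exp _).trans ?_)
    rw [Real.exp_sum]
    refine Finset.prod_le_prod (fun j _ => (Real.exp_pos _).le) fun j _ => ?_
    have hmem := apply_mem_cycleCandidates hf j
    rw [if_pos hmem]
    have hc : (0 : ℝ) < #(G.cycleCandidates τ j f) := by
      exact_mod_cast Finset.card_pos.2 ⟨_, hmem⟩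
    have hx : 0 < (#(G.cycleCandidates τ j f) : ℝ) / b j := div_pos hc (hb j)
    have : b j * (#(G.cycleCandidates τ j f) : ℝ)⁻¹ = ((#(G.cycleCandidates τ j f) : ℝ) / b j)⁻¹ := by
      rw [inv_div, div_eq_mul_inv]
    rw [this, show (1 : ℝ) - #(G.cycleCandidates τ j f) / b j
      = -(#(G.cycleCandidates τ j f) / b j - 1) by ring, Real.exp_neg]
    refine inv_anti₀ hx ?_
    have := Real.add_one_le_exp ((#(G.cycleCandidates τ j f) : ℝ) / b j - 1)
    linarith
  calc _ ≤ ∑ f ∈ G.goodCycleHoms k τ, (∏ j, b j) * ∏ j,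
        (if f j ∈ G.cycleCandidates τ j f then (#(G.cycleCandidates τ j f) : ℝ)⁻¹ else 0) :=
        Finset.sum_le_sum hpt
    _ ≤ ∑ f : ZMod k → V, (∏ j, b j) * ∏ j,
        (if f j ∈ G.cycleCandidates τ j f then (#(G.cycleCandidates τ j f) : ℝ)⁻¹ else 0) :=
        Finset.sum_le_sum_of_subset_of_nonneg (Finset.subset_univ _) fun f _ _ =>
          mul_nonneg hB.le (Finset.prod_nonneg fun j _ => by split_ifs <;> positivity)
    _ ≤ ∏ j, b j := by
        rw [← Finset.mul_sum]
        exact mul_le_of_le_one_right hB.le hseq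

/-- The indices of a cycle adjacent to `z`. -/
def cycleNeighbors (G : SimpleGraph V) [DecidableRel G.Adj] (f : ZMod k → V) (z : V) :
    Finset (ZMod k) := {i | G.Adj z (f i)}

/-- The indices of a cycle having at least `τ` common neighbours with `z`. -/
noncomputable def cycleSecondNeighbors (G : SimpleGraph V) [DecidableRel G.Adj] (τ : ℝ)
    (f : ZMod k → V) (z : V) : Finset (ZMod k) := {i | τ ≤ (G.adjMatrix ℝ ^ 2) z (f i)}

/-- The sizes of the candidate sets, summed over all good homomorphisms, in terms of the weights. -/
theorem sum_card_cycleCandidates [Nonempty V] (hk : 5 ≤ k) :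
    ∑ f ∈ G.goodCycleHoms k τ, ∑ j, (1 - #(G.cycleCandidates τ j f) /
        (if j = 0 then (Fintype.card V : ℝ) else if j = 1 then 2 * (Fintype.card V / k)
          else Fintype.card V / k))
      = #(G.goodCycleHoms k τ) * (k - 1) - (∑ f ∈ G.goodCycleHoms k τ, ∑ z,
          cycleWeight (G.cycleNeighbors f z) (G.cycleSecondNeighbors τ f z))
            / (2 * Fintype.card V) := by
  set H := G.goodCycleHoms k τ with hH
  set n : ℝ := (Fintype.card V : ℝ) with hn
  have hn0 : 0 < n := by rw [hn]; exact_mod_cast Fintype.card_pos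
  have hk0 : (0 : ℝ) < k := by exact_mod_cast (by omega : 0 < k)
  -- By symmetry only three totals matter: degrees `D`, codegrees at distance two `Q`, and the
  -- candidates `X` for index `3`.
  obtain ⟨D, hD⟩ : ∃ D : ℝ, D = ∑ f ∈ H, (#(G.neighborFinset (f 0)) : ℝ) := ⟨_, rfl⟩
  obtain ⟨Q, hQ⟩ : ∃ Q : ℝ, Q = ∑ f ∈ H, (#(G.neighborFinset (f 0) ∩ G.neighborFinset (f 2)) : ℝ) :=
    ⟨_, rfl⟩
  obtain ⟨X, hX⟩ : ∃ X : ℝ, X = ∑ f ∈ H, (#{z | τ ≤ (G.adjMatrix ℝ ^ 2) z (f 1) ∧ ¬ G.Adj z (f 0)} : ℝ) :=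
    ⟨_, rfl⟩
  have hadd : ∀ (F : V → V → ℝ) (a b a' b' c : ZMod k), a' = a + c → b' = b + c →
      ∑ f ∈ H, F (f a') (f b') = ∑ f ∈ H, F (f a) (f b) := by
    rintro F a b _ _ c rfl rfl
    exact sum_goodCycleHoms_comp_add c fun f => F (f a) (f b)
  have hsub : ∀ (F : V → V → ℝ) (a b a' b' c : ZMod k), a' = c - a → b' = c - b →
      ∑ f ∈ H, F (f a') (f b') = ∑ f ∈ H, F (f a) (f b) := by
    rintro F a b _ _ c rfl rfl
    exact sum_goodCycleHoms_comp_sub c fun f => F (f a) (f b)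
  have hDi : ∀ i, ∑ f ∈ H, (#(G.neighborFinset (f i)) : ℝ) = D := fun i => by
    rw [hD]
    exact hadd (fun u _ => (#(G.neighborFinset u) : ℝ)) 0 0 i i i (by ring) (by ring)
  have hQi : ∀ i, ∑ f ∈ H, (#(G.neighborFinset (f i) ∩ G.neighborFinset (f (i + 2))) : ℝ) = Q :=
    fun i => by
      rw [hQ]
      exact hadd (fun u v => (#(G.neighborFinset u ∩ G.neighborFinset v) : ℝ)) 0 2 i (i + 2) i
        (by ring) (by ring)
  have hX1 : ∀ i, ∑ f ∈ H,
      (#{z | τ ≤ (G.adjMatrix ℝ ^ 2) z (f i) ∧ ¬ G.Adj z (f (i - 1))} : ℝ) = X := fun i => by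
    rw [hX]
    exact hadd (fun u v => (#{z | τ ≤ (G.adjMatrix ℝ ^ 2) z u ∧ ¬ G.Adj z v} : ℝ)) 1 0 i (i - 1)
      (i - 1) (by ring) (by ring)
  have hX2 : ∀ i, ∑ f ∈ H,
      (#{z | τ ≤ (G.adjMatrix ℝ ^ 2) z (f i) ∧ ¬ G.Adj z (f (i + 1))} : ℝ) = X := fun i => by
    rw [hX]
    exact hsub (fun u v => (#{z | τ ≤ (G.adjMatrix ℝ ^ 2) z u ∧ ¬ G.Adj z v} : ℝ)) 1 0 i (i + 1)
      (i + 1) (by ring) (by ring)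
  have hR : ∀ j, ∑ f ∈ H, (#(G.neighborFinset (f (j - 1)) \ G.neighborFinset (f (j - 3))) : ℝ)
      = D - Q := by
    intro j
    rw [← hDi (j - 1), ← hQi (j - 3), ← Finset.sum_sub_distrib]
    refine Finset.sum_congr rfl fun f _ => ?_
    rw [show j - 3 + 2 = j - 1 by ring, eq_sub_iff_add_eq]
    rw [Finset.inter_comm]
    exact_mod_cast Finset.card_sdiff_add_card_inter _ _
  have hW : ∑ f ∈ H, ∑ z, cycleWeight (G.cycleNeighbors f z) (G.cycleSecondNeighbors τ f z)
      = k * ((2 * k - 9) * D - (2 * k - 14) * Q + 2 * X) := by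
    have hf : ∀ f : ZMod k → V,
        ∑ z, cycleWeight (G.cycleNeighbors f z) (G.cycleSecondNeighbors τ f z)
        = ∑ i, ((2 * k - 9) * (#(G.neighborFinset (f i)) : ℝ)
          - (2 * k - 14) * (#(G.neighborFinset (f i) ∩ G.neighborFinset (f (i + 2))) : ℝ)
          + (#{z | τ ≤ (G.adjMatrix ℝ ^ 2) z (f i) ∧ ¬ G.Adj z (f (i - 1))} : ℝ)
          + (#{z | τ ≤ (G.adjMatrix ℝ ^ 2) z (f i) ∧ ¬ G.Adj z (f (i + 1))} : ℝ)) := by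
      intro f
      simp only [cycleWeight]
      rw [Finset.sum_comm]
      refine Finset.sum_congr rfl fun i _ => ?_
      have a1 : (#(G.neighborFinset (f i)) : ℝ)
          = ∑ z, if i ∈ G.cycleNeighbors f z then (1 : ℝ) else 0 := by
        rw [Finset.sum_boole]
        congr 2
        ext z; simp [cycleNeighbors, G.adj_comm]
      have a2 : (#(G.neighborFinset (f i) ∩ G.neighborFinset (f (i + 2))) : ℝ)
          = ∑ z, if i ∈ G.cycleNeighbors f z ∧ i + 2 ∈ G.cycleNeighbors f z
            then (1 : ℝ) else 0 := by
        rw [Finset.sum_boole]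
        congr 2
        ext z; simp [cycleNeighbors, G.adj_comm]
      rw [a1, a2, Finset.card_filter, Finset.card_filter]
      push_cast
      rw [Finset.mul_sum, Finset.mul_sum, ← Finset.sum_sub_distrib, ← Finset.sum_add_distrib,
        ← Finset.sum_add_distrib]
      refine Finset.sum_congr rfl fun z _ => ?_
      rw [add_assoc]
      congr 1
      simp only [cycleNeighbors, cycleSecondNeighbors, Finset.mem_filter, Finset.mem_univ,
        true_and]
      by_cases h1 : τ ≤ (G.adjMatrix ℝ ^ 2) z (f i) <;> by_cases h2 : G.Adj z (f (i - 1)) <;>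
        by_cases h3 : G.Adj z (f (i + 1)) <;> norm_num [h1, h2, h3]
    rw [Finset.sum_congr rfl fun f _ => hf f, Finset.sum_comm]
    have hi : ∀ i, ∑ f ∈ H, ((2 * k - 9) * (#(G.neighborFinset (f i)) : ℝ)
          - (2 * k - 14) * (#(G.neighborFinset (f i) ∩ G.neighborFinset (f (i + 2))) : ℝ)
          + (#{z | τ ≤ (G.adjMatrix ℝ ^ 2) z (f i) ∧ ¬ G.Adj z (f (i - 1))} : ℝ)
          + (#{z | τ ≤ (G.adjMatrix ℝ ^ 2) z (f i) ∧ ¬ G.Adj z (f (i + 1))} : ℝ))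
          = (2 * k - 9) * D - (2 * k - 14) * Q + 2 * X := by
      intro i
      rw [Finset.sum_add_distrib, Finset.sum_add_distrib, Finset.sum_sub_distrib,
        ← Finset.mul_sum, ← Finset.mul_sum, hDi, hQi, hX1, hX2]
      ring
    rw [Finset.sum_congr rfl fun i _ => hi i, Finset.sum_const, Finset.card_univ, ZMod.card,
      nsmul_eq_mul]
  have hj : ∀ j : ZMod k, ∑ f ∈ H, (1 - (#(G.cycleCandidates τ j f) : ℝ) /
        (if j = 0 then n else if j = 1 then 2 * (n / k) else n / k))
      = if j = 0 then 0 else if j = 1 then #H - D / (2 * (n / k)) else if j = 2 then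
        #H - Q / (n / k) else if j = 3 then #H - X / (n / k) else if j = -1 then
        #H - Q / (n / k) else #H - (D - Q) / (n / k) := by
    intro j
    rw [Finset.sum_sub_distrib, ← Finset.sum_div]
    simp only [cycleCandidates]
    rw [show ∑ f ∈ H, (1 : ℝ) = #H by simp]
    split_ifs with g0 g1 g2 g3 g4
    · rw [Finset.sum_const, Finset.card_univ, nsmul_eq_mul, ← hn]
      field_simp
      ring
    · rw [hDi]
    · have := hQi 1
      rw [show (1 : ZMod k) + 2 = 3 by norm_num] at this
      rw [this]
    · rw [hX]
    · have := hQi (-2)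
      rw [show (-2 : ZMod k) + 2 = 0 by norm_num] at this
      rw [this]
    · rw [hR]
  rw [Finset.sum_comm, Finset.sum_congr rfl fun j _ => hj j, ZMod.sum_ite_small_residues hk, hW]
  field_simp
  ring

/-- Good homomorphisms are at most as many as in the balanced blow-up, up to an error counting
the pairs of a homomorphism and a vertex of large weight. -/
theorem card_goodCycleHoms_le [Nonempty V] (hk7 : 7 ≤ k) :
    (#(G.goodCycleHoms k τ) : ℝ) ≤ 2 * k * (Fintype.card V / k : ℝ) ^ k +
      k ^ 2 / Fintype.card V * ∑ f ∈ G.goodCycleHoms k τ, (#{z | 2 * (k : ℝ) - 2 <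
        cycleWeight (G.cycleNeighbors f z) (G.cycleSecondNeighbors τ f z)} : ℝ) := by
  have hn0 : (0 : ℝ) < Fintype.card V := by exact_mod_cast Fintype.card_pos
  have hk0 : (0 : ℝ) < k := by exact_mod_cast (by omega : 0 < k)
  have h10 : (1 : ZMod k) ≠ 0 := (ZMod.small_residues_ne (by omega : 5 ≤ k)).1.1
  -- These are the sizes of the candidate sets in the balanced blow-up: everything, then two
  -- classes, then one class each.
  set b : ZMod k → ℝ := fun j => if j = 0 then (Fintype.card V : ℝ) else
    if j = 1 then 2 * (Fintype.card V / k) else Fintype.card V / k with hb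
  have hb0 : ∀ j, 0 < b j := fun j => by simp only [hb]; split_ifs <;> positivity
  have hprod : ∏ j, b j = 2 * k * (Fintype.card V / k : ℝ) ^ k := by
    have : ∀ j, b j = (Fintype.card V / k) * ((if j = 0 then (k : ℝ) else 1) *
        (if j = 1 then 2 else 1)) := by
      intro j
      simp only [hb]
      by_cases h0 : j = 0
      · subst h0; simp [h10.symm]
      · by_cases h1 : j = 1
        · subst h1; simp [h10, mul_comm]
        · simp [h0, h1]
    rw [Finset.prod_congr rfl fun j _ => this j, Finset.prod_mul_distrib, Finset.prod_mul_distrib]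
    simp [ZMod.card]
    ring
  have h1 := sum_goodCycleHoms_le_prod (G := G) (τ := τ) (by omega : 5 ≤ k) b hb0
  rw [hprod, Finset.sum_add_distrib, sum_card_cycleCandidates (by omega)] at h1
  have h2 : ∑ f ∈ G.goodCycleHoms k τ, ∑ z,
      cycleWeight (G.cycleNeighbors f z) (G.cycleSecondNeighbors τ f z)
      ≤ ∑ f ∈ G.goodCycleHoms k τ, (Fintype.card V * (2 * (k : ℝ) - 2) +
        2 * (k : ℝ) ^ 2 * (#{z | 2 * (k : ℝ) - 2 <
        cycleWeight (G.cycleNeighbors f z) (G.cycleSecondNeighbors τ f z)} : ℝ)) := by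
    refine Finset.sum_le_sum fun f _ => ?_
    calc _ ≤ ∑ z, ((2 * (k : ℝ) - 2) + 2 * (k : ℝ) ^ 2 * (if 2 * (k : ℝ) - 2 <
          cycleWeight (G.cycleNeighbors f z) (G.cycleSecondNeighbors τ f z) then 1 else 0)) := by
          refine Finset.sum_le_sum fun z _ => ?_
          have hk1 : (7 : ℝ) ≤ k := by exact_mod_cast hk7
          have := cycleWeight_le hk7 (G.cycleNeighbors f z) (G.cycleSecondNeighbors τ f z)
          split_ifs with h
          · linarith
          · linarith
      _ = _ := by
          rw [Finset.sum_add_distrib, ← Finset.mul_sum, Finset.sum_boole, Finset.sum_const,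
            Finset.card_univ, nsmul_eq_mul]
  rw [Finset.sum_add_distrib, Finset.sum_const, ← Finset.mul_sum, nsmul_eq_mul] at h2
  set B := ∑ f ∈ G.goodCycleHoms k τ, (#{z | 2 * (k : ℝ) - 2 <
        cycleWeight (G.cycleNeighbors f z) (G.cycleSecondNeighbors τ f z)} : ℝ)
  simp only [Finset.sum_const, nsmul_eq_mul, mul_one] at h1
  have h3 := div_le_div_of_nonneg_right h2 (by positivity : 0 ≤ 2 * (Fintype.card V : ℝ))
  have h4 : (#(G.goodCycleHoms k τ) * (Fintype.card V * (2 * (k : ℝ) - 2)) + 2 * (k : ℝ) ^ 2 * B)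
      / (2 * (Fintype.card V : ℝ)) = #(G.goodCycleHoms k τ) * (k - 1)
        + k ^ 2 / Fintype.card V * B := by
    field_simp
  rw [h4] at h3
  linarith
end SimpleGraph

/-! ### Error terms controlled by short odd closed walks -/

namespace SimpleGraph
variable {V : Type*} [Fintype V] [DecidableEq V] {G : SimpleGraph V} [DecidableRel G.Adj]
  {k : ℕ} [NeZero k] {ε τ : ℝ}

/-- If closed walks of length `d + r` are sparse then few homomorphisms of the cycle are closed up
by a walk of length `r` between the images of two vertices at distance `d`. -/
theorem sum_cycleHoms_adjMatrix_pow_le {d r : ℕ} (hr : 1 ≤ r) (hd : d + 1 ≤ k)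
    (h : (G.adjMatrix ℝ ^ (d + r)).trace ≤ ε * (Fintype.card V : ℝ) ^ (d + r)) (i : ZMod k) :
    ∑ f ∈ G.cycleHoms k, (G.adjMatrix ℝ ^ r) (f i) (f (i + d))
      ≤ ε * (Fintype.card V : ℝ) ^ (k + r - 1) := by
  refine (sum_cycleHoms_le G hd i _ fun u v => G.adjMatrix_pow_nonneg r u v).trans ?_
  rw [trace_adjMatrix_pow_add]
  calc _ ≤ (Fintype.card V : ℝ) ^ (k - d - 1) * (ε * (Fintype.card V : ℝ) ^ (d + r)) := by gcongr
    _ = ε * (Fintype.card V : ℝ) ^ (k + r - 1) := by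
        rw [mul_left_comm, ← pow_add]
        congr 2
        omega

/-- A chord spanning three edges closes the other `k - 3` edges of the cycle into a closed walk of
length `k - 2`. -/
theorem card_cycleHoms_chord_le (hk7 : 7 ≤ k)
    (h : (G.adjMatrix ℝ ^ (k - 2)).trace ≤ ε * (Fintype.card V : ℝ) ^ (k - 2)) (i : ZMod k) :
    (#{f ∈ G.cycleHoms k | G.Adj (f i) (f (i + 3))} : ℝ) ≤ ε * (Fintype.card V : ℝ) ^ k := by
  have hk : k - 2 = (k - 3) + 1 := by omega
  rw [hk] at h
  have := sum_cycleHoms_adjMatrix_pow_le (k := k) le_rfl (by omega) h (i + 3)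
  rw [Nat.add_sub_cancel] at this
  refine le_trans (le_of_eq ?_) this
  rw [Finset.card_filter]
  push_cast
  refine Finset.sum_congr rfl fun f _ => ?_
  rw [pow_one, Nat.cast_sub (by omega), ZMod.natCast_self,
    show i + 3 + (0 - ((3 : ℕ) : ZMod k)) = i by push_cast; ring, G.adjMatrix_comm,
    adjMatrix_apply]

/-- At most `n ^ 2` pairs of ends occur, each with fewer than `τ` middle vertices; the other `k - 3`
vertices are free. -/
theorem card_cycleHoms_codegree_lt_le (hk7 : 7 ≤ k) (hτ : 0 ≤ τ) (i : ZMod k) :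
    (#{f ∈ G.cycleHoms k | (G.adjMatrix ℝ ^ 2) (f i) (f (i + 2)) < τ} : ℝ)
      ≤ τ * (Fintype.card V : ℝ) ^ (k - 1) := by
  have := sum_cycleHoms_le G (k := k) (d := 2) (by omega) i
    (fun u v => if (G.adjMatrix ℝ ^ 2) u v < τ then 1 else 0)
    (fun u v => by split_ifs <;> norm_num)
  push_cast at this
  rw [Finset.card_filter]
  push_cast
  refine this.trans ?_
  calc _ ≤ (Fintype.card V : ℝ) ^ (k - 2 - 1) * ∑ u : V, ∑ v : V, τ := by
        gcongr with u _ v _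
        split_ifs with h
        · linarith
        · simpa using hτ
    _ = τ * ((Fintype.card V : ℝ) ^ (k - 2 - 1) * (Fintype.card V : ℝ) ^ 2) := by
        simp only [Finset.sum_const, Finset.card_univ, nsmul_eq_mul]; ring
    _ = _ := by
        rw [← pow_add]
        congr 2
        omega

/-- Homomorphisms of the cycle are good up to a small error. -/
theorem card_cycleHoms_le_card_goodCycleHoms_add (hk7 : 7 ≤ k) (hτ : 0 ≤ τ)
    (h : (G.adjMatrix ℝ ^ (k - 2)).trace ≤ ε * (Fintype.card V : ℝ) ^ (k - 2)) :
    (#(G.cycleHoms k) : ℝ) ≤ #(G.goodCycleHoms k τ) + k * (ε * (Fintype.card V : ℝ) ^ k)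
      + k * (τ * (Fintype.card V : ℝ) ^ (k - 1)) := by
  have hsub : G.cycleHoms k ⊆ G.goodCycleHoms k τ ∪
      (Finset.univ.biUnion fun i => {f ∈ G.cycleHoms k | G.Adj (f i) (f (i + 3))}) ∪
      (Finset.univ.biUnion fun i =>
        {f ∈ G.cycleHoms k | (G.adjMatrix ℝ ^ 2) (f i) (f (i + 2)) < τ}) := by
    intro f hf
    by_contra hne
    simp only [Finset.mem_union, Finset.mem_biUnion, Finset.mem_univ, true_and,
      Finset.mem_filter, hf, not_or, not_exists, not_lt] at hne
    refine hne.1.1 ?_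
    rw [goodCycleHoms, Finset.mem_filter]
    exact ⟨hf, fun i => ⟨hne.1.2 i, hne.2 i⟩⟩
  have hcard : (#(G.cycleHoms k) : ℝ) ≤ #(G.goodCycleHoms k τ) +
      ∑ i, (#{f ∈ G.cycleHoms k | G.Adj (f i) (f (i + 3))} : ℝ) +
      ∑ i, (#{f ∈ G.cycleHoms k | (G.adjMatrix ℝ ^ 2) (f i) (f (i + 2)) < τ} : ℝ) := by
    have := (Finset.card_le_card hsub).trans (Finset.card_union_le _ _)
    have h2 := this.trans (add_le_add (Finset.card_union_le _ _) le_rfl)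
    have h3 := h2.trans (add_le_add (add_le_add le_rfl Finset.card_biUnion_le)
      Finset.card_biUnion_le)
    exact_mod_cast h3
  refine hcard.trans ?_
  have hc : ∀ x : ℝ, ∑ _i : ZMod k, x = k * x := fun x => by simp [ZMod.card]
  refine add_le_add (add_le_add le_rfl ?_) ?_
  · rw [← hc]
    exact Finset.sum_le_sum fun i _ => card_cycleHoms_chord_le hk7 h i
  · rw [← hc]
    exact Finset.sum_le_sum fun i _ => card_cycleHoms_codegree_lt_le hk7 hτ i

/-- The number of vertices of large weight is bounded by the number of short odd closed walks
using the cycle. -/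
theorem card_lt_cycleWeight_le (hk : Odd k) (hk7 : 7 ≤ k) (hτ : 0 < τ) (f : ZMod k → V) :
    (#{z | 2 * (k : ℝ) - 2 <
        cycleWeight (G.cycleNeighbors f z) (G.cycleSecondNeighbors τ f z)} : ℝ)
      ≤ ∑ i, ∑ d ∈ (Finset.range k).filter (fun d => Odd d ∧ d + 4 ≤ k),
          (G.adjMatrix ℝ ^ 2) (f i) (f (i + d))
        + 2 * τ⁻¹ * ∑ i, ∑ d ∈ (Finset.range k).filter (fun d => Even d ∧ d + 5 ≤ k),
          (G.adjMatrix ℝ ^ 3) (f i) (f (i + d))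
        + (τ⁻¹) ^ 2 * (G.adjMatrix ℝ ^ 4) (f 0) (f (0 + (1 : ℕ))) := by
  set A := G.adjMatrix ℝ with hA
  have hA0 : ∀ r u v, 0 ≤ (A ^ r) u v := fun r u v => G.adjMatrix_pow_nonneg r u v
  have hA1 : ∀ u v, G.Adj u v → (A ^ 1) u v = 1 := fun u v h => by
    rw [pow_one, hA, adjMatrix_apply, if_pos h]
  have hτ1 : ∀ x, τ ≤ x → 1 ≤ τ⁻¹ * x := fun x hx => by
    rw [← inv_mul_cancel₀ hτ.ne']
    gcongr
  have hpow : ∀ a b u v, (A ^ (a + b)) u v = ∑ z, (A ^ a) u z * (A ^ b) z v := fun a b u v => by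
    rw [pow_add, Matrix.mul_apply]
  -- A vertex of large weight violates a hypothesis of `cycleWeight_le_of_sparse`, which makes one
  -- of the terms at least `1`. Each membership in the second-neighbour set supplies at least `τ`
  -- two-step walks, hence one factor `τ⁻¹`.
  have key : ∀ z, (if 2 * (k : ℝ) - 2 <
        cycleWeight (G.cycleNeighbors f z) (G.cycleSecondNeighbors τ f z) then (1 : ℝ) else 0)
      ≤ ∑ i, ∑ d ∈ (Finset.range k).filter (fun d => Odd d ∧ d + 4 ≤ k),
          (A ^ 1) (f i) z * (A ^ 1) z (f (i + d))
        + (τ⁻¹ * ∑ i, ∑ d ∈ (Finset.range k).filter (fun d => Even d ∧ d + 5 ≤ k),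
          (A ^ 1) (f i) z * (A ^ 2) z (f (i + d))
        + τ⁻¹ * ∑ i, ∑ d ∈ (Finset.range k).filter (fun d => Even d ∧ d + 5 ≤ k),
          (A ^ 2) (f i) z * (A ^ 1) z (f (i + d)))
        + (τ⁻¹) ^ 2 * ((A ^ 2) (f 0) z * (A ^ 2) z (f (0 + (1 : ℕ)))) := by
    intro z
    have hnn : ∀ (s : Finset ℕ) (a b : ℕ), 0 ≤ ∑ i : ZMod k, ∑ d ∈ s,
        (A ^ a) (f i) z * (A ^ b) z (f (i + d)) := fun s a b =>
      Finset.sum_nonneg fun i _ => Finset.sum_nonneg fun d _ => mul_nonneg (hA0 _ _ _) (hA0 _ _ _)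
    have hsingle : ∀ (s : Finset ℕ) (a b : ℕ) (i : ZMod k) (d : ℕ), d ∈ s →
        (A ^ a) (f i) z * (A ^ b) z (f (i + d)) ≤ ∑ i : ZMod k, ∑ d ∈ s,
        (A ^ a) (f i) z * (A ^ b) z (f (i + d)) := fun s a b i d hd =>
      (Finset.single_le_sum (f := fun d : ℕ => (A ^ a) (f i) z * (A ^ b) z (f (i + d)))
        (fun d _ => mul_nonneg (hA0 _ _ _) (hA0 _ _ _)) hd).trans
      (Finset.single_le_sum (f := fun i : ZMod k => ∑ d ∈ s,
        (A ^ a) (f i) z * (A ^ b) z (f (i + d)))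
        (fun i _ => Finset.sum_nonneg fun d _ => mul_nonneg (hA0 _ _ _) (hA0 _ _ _))
        (Finset.mem_univ i))
    have n1 := hnn ((Finset.range k).filter (fun d => Odd d ∧ d + 4 ≤ k)) 1 1
    have n2 := mul_nonneg (inv_nonneg.2 hτ.le)
      (hnn ((Finset.range k).filter (fun d => Even d ∧ d + 5 ≤ k)) 1 2)
    have n3 := mul_nonneg (inv_nonneg.2 hτ.le)
      (hnn ((Finset.range k).filter (fun d => Even d ∧ d + 5 ≤ k)) 2 1)
    have n4 : 0 ≤ (τ⁻¹) ^ 2 * ((A ^ 2) (f 0) z * (A ^ 2) z (f (0 + (1 : ℕ)))) :=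
      mul_nonneg (by positivity) (mul_nonneg (hA0 _ _ _) (hA0 _ _ _))
    split_ifs with hbad
    swap
    · linarith
    by_contra hlt
    refine absurd (cycleWeight_le_of_sparse hk hk7 (P := G.cycleNeighbors f z)
      (S := G.cycleSecondNeighbors τ f z) ?_ ?_ ?_ ?_) (not_le.2 hbad)
    · intro i hi d hd hdk hj
      simp only [cycleNeighbors, Finset.mem_filter, Finset.mem_univ, true_and] at hi hj
      have := hsingle ((Finset.range k).filter (fun d => Odd d ∧ d + 4 ≤ k)) 1 1 i d
        (by simp only [Finset.mem_filter, Finset.mem_range]; exact ⟨by omega, hd, hdk⟩)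
      rw [hA1 _ _ hi.symm, hA1 _ _ hj] at this
      linarith
    · intro i hi d hd hdk hj
      simp only [cycleNeighbors, cycleSecondNeighbors, Finset.mem_filter, Finset.mem_univ,
        true_and] at hi hj
      have := mul_le_mul_of_nonneg_left
        (hsingle ((Finset.range k).filter (fun d => Even d ∧ d + 5 ≤ k)) 1 2 i d
        (by simp only [Finset.mem_filter, Finset.mem_range]; exact ⟨by omega, hd, hdk⟩))
        (inv_nonneg.2 hτ.le)
      rw [hA1 _ _ hi.symm, one_mul] at this
      have := hτ1 _ hj
      linarith
    · intro i hi d hd hdk hj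
      simp only [cycleNeighbors, cycleSecondNeighbors, Finset.mem_filter, Finset.mem_univ,
        true_and] at hi hj
      have := mul_le_mul_of_nonneg_left
        (hsingle ((Finset.range k).filter (fun d => Even d ∧ d + 5 ≤ k)) 2 1 i d
        (by simp only [Finset.mem_filter, Finset.mem_range]; exact ⟨by omega, hd, hdk⟩))
        (inv_nonneg.2 hτ.le)
      rw [hA1 _ _ hj, mul_one] at this
      rw [← hA, hA, G.adjMatrix_pow_comm] at hi
      have := hτ1 _ hi
      linarith
    · rintro ⟨h0, h1⟩
      simp only [cycleSecondNeighbors, Finset.mem_filter, Finset.mem_univ, true_and] at h0 h1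
      rw [← hA, hA, G.adjMatrix_pow_comm] at h0
      have h2 := hτ1 _ h0
      have h3 := hτ1 _ h1
      have h4 : (1 : ℝ) ≤ (τ⁻¹ * (A ^ 2) (f 0) z) * (τ⁻¹ * (A ^ 2) z (f 1)) :=
        one_le_mul_of_one_le_of_one_le h2 h3
      have h5 : (τ⁻¹) ^ 2 * ((A ^ 2) (f 0) z * (A ^ 2) z (f (0 + (1 : ℕ))))
          = (τ⁻¹ * (A ^ 2) (f 0) z) * (τ⁻¹ * (A ^ 2) z (f 1)) := by
        rw [Nat.cast_one, zero_add]; ring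
      linarith
  have hswap : ∀ (s : Finset ℕ) (a b : ℕ), ∑ z, ∑ i : ZMod k, ∑ d ∈ s,
      (A ^ a) (f i) z * (A ^ b) z (f (i + d))
      = ∑ i : ZMod k, ∑ d ∈ s, (A ^ (a + b)) (f i) (f (i + d)) := fun s a b => by
    rw [Finset.sum_comm]
    refine Finset.sum_congr rfl fun i _ => ?_
    rw [Finset.sum_comm]
    exact Finset.sum_congr rfl fun d _ => (hpow a b _ _).symm
  rw [Finset.card_filter]
  push_cast
  refine (Finset.sum_le_sum fun z _ => key z).trans_eq ?_
  rw [Finset.sum_add_distrib, Finset.sum_add_distrib, Finset.sum_add_distrib, ← Finset.mul_sum,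
    ← Finset.mul_sum, ← Finset.mul_sum, hswap, hswap, hswap, ← hpow]
  push_cast
  ring

/-- The number of pairs of a homomorphism of the cycle and a vertex of large weight. -/
theorem sum_card_lt_cycleWeight_le (hk : Odd k) (hk7 : 7 ≤ k) (hτ : 0 < τ) (hε : 0 ≤ ε)
    (h : ∀ l, Odd l → 3 ≤ l → l + 2 ≤ k →
      (G.adjMatrix ℝ ^ l).trace ≤ ε * (Fintype.card V : ℝ) ^ l) :
    ∑ f ∈ G.goodCycleHoms k τ, (#{z | 2 * (k : ℝ) - 2 <
        cycleWeight (G.cycleNeighbors f z) (G.cycleSecondNeighbors τ f z)} : ℝ)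
      ≤ k ^ 2 * (ε * (Fintype.card V : ℝ) ^ (k + 1))
        + 2 * τ⁻¹ * (k ^ 2 * (ε * (Fintype.card V : ℝ) ^ (k + 2)))
        + (τ⁻¹) ^ 2 * (ε * (Fintype.card V : ℝ) ^ (k + 3)) := by
  have hsum : ∀ (p : ℕ → Prop) [DecidablePred p] (r : ℕ), 1 ≤ r →
      (∀ d, p d → d + 1 ≤ k ∧ Odd (d + r) ∧ 3 ≤ d + r ∧ d + r + 2 ≤ k) →
      ∑ f ∈ G.cycleHoms k, ∑ i, ∑ d ∈ (Finset.range k).filter p,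
          (G.adjMatrix ℝ ^ r) (f i) (f (i + d))
        ≤ k ^ 2 * (ε * (Fintype.card V : ℝ) ^ (k + r - 1)) := by
    intro p _ r hr hp
    rw [Finset.sum_comm]
    calc _ ≤ ∑ i : ZMod k, k * (ε * (Fintype.card V : ℝ) ^ (k + r - 1)) := by
          refine Finset.sum_le_sum fun i _ => ?_
          rw [Finset.sum_comm]
          refine (Finset.sum_le_card_nsmul _ _ (ε * (Fintype.card V : ℝ) ^ (k + r - 1))
            fun d hd => ?_).trans ?_
          · obtain ⟨h1, h2, h3, h4⟩ := hp d (Finset.mem_filter.1 hd).2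
            exact sum_cycleHoms_adjMatrix_pow_le hr h1 (h _ h2 h3 h4) i
          · rw [nsmul_eq_mul]
            gcongr
            exact (Finset.card_filter_le _ _).trans_eq (Finset.card_range k)
      _ = _ := by
          rw [Finset.sum_const, Finset.card_univ, ZMod.card, nsmul_eq_mul]; ring
  calc _ ≤ ∑ f ∈ G.cycleHoms k, (#{z | 2 * (k : ℝ) - 2 <
        cycleWeight (G.cycleNeighbors f z) (G.cycleSecondNeighbors τ f z)} : ℝ) :=
        Finset.sum_le_sum_of_subset_of_nonneg (Finset.filter_subset _ _)
          fun _ _ _ => Nat.cast_nonneg _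
    _ ≤ _ := Finset.sum_le_sum fun f _ => card_lt_cycleWeight_le hk hk7 hτ f
    _ ≤ _ := by
        rw [Finset.sum_add_distrib, Finset.sum_add_distrib, ← Finset.mul_sum, ← Finset.mul_sum]
        refine add_le_add (add_le_add ?_ ?_) ?_
        · exact hsum _ 2 (by norm_num) fun d hd =>
            ⟨by omega, hd.1.add_even even_two, by have := hd.1.pos; omega, by omega⟩
        · refine mul_le_mul_of_nonneg_left ?_ (by positivity)
          exact hsum _ 3 (by norm_num) fun d hd =>
            ⟨by omega, hd.1.add_odd (by decide), by omega, by omega⟩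
        · refine mul_le_mul_of_nonneg_left ?_ (by positivity)
          exact sum_cycleHoms_adjMatrix_pow_le (by norm_num) (by omega)
            (h _ (by decide) (by norm_num) (by omega)) 0

/-- If short odd closed walks are sparse then homomorphisms of the `k`-cycle are asymptotically at
most as many as in the balanced blow-up. -/
theorem card_cycleHoms_le [Nonempty V] (hk : Odd k) (hk7 : 7 ≤ k) {δ : ℝ} (hδ : 0 < δ) (hε : 0 ≤ ε)
    (h : ∀ l, Odd l → 3 ≤ l → l + 2 ≤ k →
      (G.adjMatrix ℝ ^ l).trace ≤ ε * (Fintype.card V : ℝ) ^ l) :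
    (#(G.cycleHoms k) : ℝ) ≤ 2 * k * (Fintype.card V / k : ℝ) ^ k +
      ((k ^ 2 * (k ^ 2 + 2 * k ^ 2 / δ + 1 / δ ^ 2) + k) * ε + k * δ) *
        (Fintype.card V : ℝ) ^ k := by
  have hn : (0 : ℝ) < Fintype.card V := by exact_mod_cast Fintype.card_pos
  -- A codegree threshold linear in `n` puts all three error terms at order `ε n ^ (k + 1)`, hence
  -- `ε n ^ k` after the factor `k ^ 2 / n`.
  have hτ : 0 < δ * Fintype.card V := by positivity
  have hodd : Odd (k - 2) := Nat.Odd.sub_even (by omega) hk even_two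
  have h1 := card_cycleHoms_le_card_goodCycleHoms_add hk7 hτ.le
    (h (k - 2) hodd (by omega) (by omega))
  have h2 := card_goodCycleHoms_le (G := G) (τ := δ * Fintype.card V) hk7
  have h3 := sum_card_lt_cycleWeight_le hk hk7 hτ hε h
  have h4 := mul_le_mul_of_nonneg_left h3
    (by positivity : 0 ≤ (k : ℝ) ^ 2 / (Fintype.card V : ℝ))
  have e1 : (k : ℝ) ^ 2 / (Fintype.card V : ℝ) * (k ^ 2 * (ε * (Fintype.card V : ℝ) ^ (k + 1))
        + 2 * (δ * Fintype.card V)⁻¹ * (k ^ 2 * (ε * (Fintype.card V : ℝ) ^ (k + 2)))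
        + ((δ * Fintype.card V)⁻¹) ^ 2 * (ε * (Fintype.card V : ℝ) ^ (k + 3)))
      = (k ^ 2 * (k ^ 2 + 2 * k ^ 2 / δ + 1 / δ ^ 2)) * ε * (Fintype.card V : ℝ) ^ k := by
    field_simp
    ring
  have e2 : δ * (Fintype.card V : ℝ) * (Fintype.card V : ℝ) ^ (k - 1)
      = δ * (Fintype.card V : ℝ) ^ k := by
    rw [mul_assoc, ← pow_succ', Nat.sub_add_cancel (by omega)]
  rw [e1] at h4
  rw [e2] at h1
  nlinarith
end SimpleGraph

/-! ### Copies versus homomorphisms, and the blow-up -/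

namespace SimpleGraph

theorem cycleGraph_succ_adj {m : ℕ} {u v : Fin (m + 1)} :
    (cycleGraph (m + 1)).Adj u v ↔ u ≠ v ∧ (u = v + 1 ∨ v = u + 1) := by
  rw [cycleGraph_eq_circulantGraph, circulantGraph_adj]
  simp [sub_eq_iff_eq_add']

/-- A subgraph isomorphic to a cycle, as a parametrized closed sequence of vertices. -/
theorem Subgraph.exists_cycle_parametrization {V : Type*} {G : SimpleGraph V} {m : ℕ} (hm : 1 ≤ m)
    {S : G.Subgraph} (hS : Nonempty (cycleGraph (m + 1) ≃g S.coe)) :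
    ∃ φ : Fin (m + 1) → V, Function.Injective φ ∧ (∀ i, G.Adj (φ i) (φ (i + 1))) ∧
      S.verts = Set.range φ ∧
      ∀ u v, S.Adj u v ↔ ∃ i, (u = φ i ∧ v = φ (i + 1)) ∨ (v = φ i ∧ u = φ (i + 1)) := by
  obtain ⟨e⟩ := hS
  have hne : ∀ i : Fin (m + 1), i ≠ i + 1 := fun i h => by
    have h1 : (1 : Fin (m + 1)) = 0 := by simpa using h.symm
    rw [Fin.one_eq_zero_iff] at h1
    omega
  have hadj : ∀ i j, S.Adj (e i : V) (e j) ↔ i ≠ j ∧ (i = j + 1 ∨ j = i + 1) := fun i j => by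
    rw [← cycleGraph_succ_adj, ← e.map_adj_iff, Subgraph.coe_adj]
  refine ⟨fun i => (e i : V), Subtype.val_injective.comp e.injective, fun i => ?_, ?_, ?_⟩
  · exact ((hadj i (i + 1)).2 ⟨hne i, Or.inr rfl⟩).adj_sub
  · ext v
    refine ⟨fun hv => ⟨e.symm ⟨v, hv⟩, by simp⟩, ?_⟩
    rintro ⟨i, rfl⟩
    exact (e i).2
  · intro u v
    constructor
    · intro h
      obtain ⟨a, rfl⟩ : ∃ a, u = e a := ⟨e.symm ⟨u, S.edge_vert h⟩, by simp⟩
      obtain ⟨b, rfl⟩ : ∃ b, v = e b := ⟨e.symm ⟨v, S.edge_vert h.symm⟩, by simp⟩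
      rw [hadj] at h
      rcases h.2 with rfl | rfl
      · exact ⟨b, Or.inr ⟨rfl, rfl⟩⟩
      · exact ⟨a, Or.inl ⟨rfl, rfl⟩⟩
    · rintro ⟨i, ⟨rfl, rfl⟩ | ⟨rfl, rfl⟩⟩
      · exact (hadj _ _).2 ⟨hne i, Or.inr rfl⟩
      · exact (hadj _ _).2 ⟨(hne i).symm, Or.inl rfl⟩

open scoped Classical in
/-- Each copy of the `k`-cycle gives rise to `2 * k` homomorphisms. -/
theorem two_mul_copyCount_cycleGraph_le {V : Type*} [Fintype V] [Nonempty V] (G : SimpleGraph V)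
    [DecidableRel G.Adj] {k : ℕ} [NeZero k] (hk : 3 ≤ k) :
    2 * k * G.copyCount (cycleGraph k) ≤ #(G.cycleHoms k) := by
  have hpar : ∀ S : G.Subgraph, Nonempty (cycleGraph k ≃g S.coe) →
      ∃ φ : ZMod k → V, Function.Injective φ ∧ (∀ i, G.Adj (φ i) (φ (i + 1))) ∧
      S.verts = Set.range φ ∧
      ∀ u v, S.Adj u v ↔ ∃ i, (u = φ i ∧ v = φ (i + 1)) ∨ (v = φ i ∧ u = φ (i + 1)) := by
    intro S hS
    obtain ⟨m, rfl⟩ : ∃ m, k = m + 1 := ⟨k - 1, by omega⟩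
    exact S.exists_cycle_parametrization (by omega) hS
  choose! φ hinj hadj hverts hSadj using hpar
  set C : Finset G.Subgraph := {S | Nonempty (cycleGraph k ≃g S.coe)} with hC
  have hcount : G.copyCount (cycleGraph k) = #C := by
    rw [copyCount, hC]
    congr!
  -- The `2k` reparametrisations of a cycle are `i ↦ c ± i`.
  set sg : Bool → ZMod k := fun b => if b then 1 else -1 with hsg
  have hsq : ∀ b, sg b * sg b = 1 := fun b => by cases b <;> simp [hsg]
  have hcard : 2 * k * #C = #(C ×ˢ (Finset.univ : Finset (ZMod k × Bool))) := by
    rw [Finset.card_product, Finset.card_univ, Fintype.card_prod, ZMod.card, Fintype.card_bool]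
    ring
  rw [hcount, hcard]
  have hmem : ∀ S ∈ C, Nonempty (cycleGraph k ≃g S.coe) := fun S hS => by simpa [hC] using hS
  refine Finset.card_le_card_of_injOn (fun x i => φ x.1 (x.2.1 + sg x.2.2 * i)) ?_ ?_
  · rintro ⟨S, c, b⟩ hS
    have hS' := hmem S (by simpa using hS)
    rw [Finset.mem_coe, mem_cycleHoms]
    intro i
    cases b
    · have := (hadj S hS' (c - (i + 1))).symm
      rw [show c - (i + 1) + 1 = c - i by ring] at this
      simpa [hsg, sub_eq_add_neg, add_comm] using this
    · simpa [hsg, add_assoc] using hadj S hS' (c + i)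
  · rintro ⟨S, c, b⟩ hS ⟨S', c', b'⟩ hS' heq
    have h1 := hmem S (by simpa using hS)
    have h2 := hmem S' (by simpa using hS')
    have hfun : ∀ i, φ S (c + sg b * i) = φ S' (c' + sg b' * i) := fun i => congrFun heq i
    -- Two parametrisations that agree after such changes of variable have the same vertices and
    -- edges; one inclusion suffices by symmetry.
    have hle : ∀ (S S' : G.Subgraph) (c c' : ZMod k) (b b' : Bool),
        Nonempty (cycleGraph k ≃g S.coe) → Nonempty (cycleGraph k ≃g S'.coe) →
        (∀ i, φ S (c + sg b * i) = φ S' (c' + sg b' * i)) → S ≤ S' := by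
      intro S S' c c' b b' h1 h2 hfun
      have hval : ∀ j, φ S j = φ S' (c' + sg b' * (sg b * (j - c))) := fun j => by
        rw [← hfun, ← mul_assoc, hsq]
        congr 1
        ring
      constructor
      · rw [hverts S h1, hverts S' h2]
        rintro _ ⟨j, rfl⟩
        exact ⟨_, (hval j).symm⟩
      · intro u v huv
        rw [hSadj S h1] at huv
        rw [hSadj S' h2]
        have hstep : ∀ j, ∃ i, (φ S j = φ S' i ∧ φ S (j + 1) = φ S' (i + 1)) ∨
            (φ S (j + 1) = φ S' i ∧ φ S j = φ S' (i + 1)) := by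
          intro j
          have hs : sg b' * sg b = 1 ∨ sg b' * sg b = -1 := by
            cases b <;> cases b' <;> simp [hsg]
          rcases hs with hs | hs
          · refine ⟨c' + (j - c), Or.inl ⟨?_, ?_⟩⟩
            · rw [hval, ← mul_assoc, hs, one_mul]
            · rw [hval, ← mul_assoc, hs, one_mul]; congr 1; ring
          · refine ⟨c' - (j + 1 - c), Or.inr ⟨?_, ?_⟩⟩
            · rw [hval, ← mul_assoc, hs]; congr 1; ring
            · rw [hval, ← mul_assoc, hs]; congr 1; ring
        obtain ⟨j, ⟨rfl, rfl⟩ | ⟨rfl, rfl⟩⟩ := huv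
        · obtain ⟨i, h | h⟩ := hstep j
          · exact ⟨i, Or.inl h⟩
          · exact ⟨i, Or.inr h⟩
        · obtain ⟨i, h | h⟩ := hstep j
          · exact ⟨i, Or.inr h⟩
          · exact ⟨i, Or.inl h⟩
    obtain rfl : S = S' := le_antisymm (hle _ _ _ _ _ _ h1 h2 hfun)
      (hle _ _ _ _ _ _ h2 h1 fun i => (hfun i).symm)
    have hc : c = c' := by simpa using hinj S h1 (hfun 0)
    subst hc
    have hb : sg b = sg b' := by simpa using hinj S h1 (hfun 1)
    have h2 : (2 : ZMod k) ≠ 0 := by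
      intro h
      have : ((2 : ℕ) : ZMod k) = 0 := by exact_mod_cast h
      rw [ZMod.natCast_eq_zero_iff] at this
      exact absurd (Nat.le_of_dvd (by norm_num) this) (by omega)
    have hb' : b = b' := by
      cases b <;> cases b' <;> simp [hsg] at hb ⊢
      · exact h2 (by linear_combination -hb)
      · exact h2 (by linear_combination hb)
    rw [hb']

/-- There is no homomorphism from an odd cycle to a longer odd cycle. -/
theorem isEmpty_hom_cycleGraph {m k : ℕ} (hm : Odd m) (hm3 : 3 ≤ m) (hmk : m < k) :
    IsEmpty (cycleGraph m →g cycleGraph k) := by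
  refine ⟨fun ψ => ?_⟩
  obtain ⟨m, rfl⟩ : ∃ m', m = m' + 1 := ⟨m - 1, by omega⟩
  obtain ⟨k, rfl⟩ : ∃ k', k = k' + 1 := ⟨k - 1, by omega⟩
  have hne : ∀ i : Fin (m + 1), i + 1 ≠ i := fun i h => by
    have h1 : (1 : Fin (m + 1)) = 0 := by simpa using h
    rw [Fin.one_eq_zero_iff] at h1
    omega
  obtain ⟨χ, hχ⟩ : ∃ χ : Fin (m + 1) → ZMod (k + 1),
      ∀ i, χ (i + 1) = χ i + 1 ∨ χ i = χ (i + 1) + 1 :=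
    ⟨ψ, fun i => (cycleGraph_succ_adj.1 (ψ.map_adj (cycleGraph_succ_adj.2
      ⟨hne i, Or.inl rfl⟩))).2⟩
  -- The steps are `±1` and sum to a multiple of the longer length. Their sum is too small in
  -- absolute value to be nonzero, yet it is odd, being a sum of an odd number of odd terms.
  have hs : ∀ i, ∃ s : ℤ, (s = 1 ∨ s = -1) ∧ χ (i + 1) - χ i = s := fun i => by
    rcases hχ i with h | h
    · exact ⟨1, Or.inl rfl, by rw [h]; simp⟩
    · exact ⟨-1, Or.inr rfl, by rw [h]; simp⟩
  choose s hs1 hs2 using hs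
  have hsum : ((∑ i, s i : ℤ) : ZMod (k + 1)) = 0 := by
    push_cast
    rw [Finset.sum_congr rfl fun i _ => (hs2 i).symm, Finset.sum_sub_distrib, sub_eq_zero]
    exact Equiv.sum_comp (Equiv.addRight (1 : Fin (m + 1))) χ
  rw [ZMod.intCast_zmod_eq_zero_iff_dvd] at hsum
  have habs : |∑ i, s i| ≤ m + 1 := by
    refine (Finset.abs_sum_le_sum_abs _ _).trans ?_
    rw [Finset.sum_congr rfl fun i _ => show |s i| = 1 by rcases hs1 i with h | h <;> simp [h]]
    simp
  have hzero : ∑ i, s i = 0 := by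
    refine Int.eq_zero_of_abs_lt_dvd hsum ?_
    push_cast
    omega
  have hdvd : (2 : ℤ) ∣ ∑ i, (s i - 1) :=
    Finset.dvd_sum fun i _ => by rcases hs1 i with h | h <;> simp [h]
  rw [Finset.sum_sub_distrib, hzero] at hdvd
  simp at hdvd
  obtain ⟨c, hc⟩ := hm
  omega

/-- The blow-up of the `k`-cycle on `n` vertices. -/
def cycleBlowup (k n : ℕ) [NeZero k] : SimpleGraph (Fin n) :=
  (cycleGraph k).comap fun x => Fin.ofNat k x.val

theorem cycleGraph_free_cycleBlowup {m k n : ℕ} [NeZero k] (hm : Odd m) (hm3 : 3 ≤ m)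
    (hmk : m < k) : (cycleGraph m).Free (cycleBlowup k n) := by
  rintro ⟨f⟩
  exact (isEmpty_hom_cycleGraph hm hm3 hmk).false
    ((⟨fun x => Fin.ofNat k x.val, fun h => h⟩ : cycleBlowup k n →g cycleGraph k).comp f.toHom)

/-- The blow-up contains all transversal cycles. -/
theorem pow_div_le_copyCount_cycleBlowup (k n : ℕ) [NeZero k] :
    (n / k) ^ k ≤ (cycleBlowup k n).copyCount (cycleGraph k) := by
  classical
  have hk : 0 < k := Nat.pos_of_ne_zero (NeZero.ne k)
  -- The vertex `i + k * g i` is member number `g i` of residue class `i`.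
  have hlt : ∀ (g : Fin k → Fin (n / k)) (i : Fin k), i.val + k * (g i).val < n := fun g i => by
    have h1 : k * ((g i).val + 1) ≤ k * (n / k) := Nat.mul_le_mul_left k (g i).2
    have h2 := Nat.mul_div_le n k
    have h3 := i.2
    rw [mul_add] at h1
    omega
  have hcol : ∀ (g : Fin k → Fin (n / k)) (i : Fin k),
      Fin.ofNat k (i.val + k * (g i).val) = i := fun g i => by
    ext
    simp [Fin.ofNat, Nat.mod_eq_of_lt i.2]
  have hinj : ∀ g : Fin k → Fin (n / k), Function.Injective
      fun i : Fin k => (⟨i.val + k * (g i).val, hlt g i⟩ : Fin n) := fun g i j h => by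
    have h' := congrArg (fun x : Fin n => Fin.ofNat k x.val) h
    simpa only [hcol] using h'
  let φ : (Fin k → Fin (n / k)) → Copy (cycleGraph k) (cycleBlowup k n) := fun g =>
    ⟨⟨fun i => ⟨i.val + k * (g i).val, hlt g i⟩, fun {a b} h => by
      show (cycleGraph k).Adj (Fin.ofNat k _) (Fin.ofNat k _)
      simpa only [hcol] using h⟩, hinj g⟩
  have hφ : ∀ g i, φ g i = (⟨i.val + k * (g i).val, hlt g i⟩ : Fin n) := fun g i => rfl
  have hcard : (n / k) ^ k = #(Finset.univ : Finset (Fin k → Fin (n / k))) := by simp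
  rw [hcard, copyCount_eq_card_image_copyToSubgraph]
  refine Finset.card_le_card_of_injOn (fun g => (φ g).toSubgraph)
    (fun g _ => Finset.mem_coe.2 (Finset.mem_image_of_mem _ (Finset.mem_univ _))) ?_
  intro g _ g' _ h
  -- The vertex set alone recovers `g`, since it meets each residue class exactly once.
  have hv := congrArg Subgraph.verts h
  simp only [Copy.toSubgraph, Subgraph.map_verts, Subgraph.verts_top, Set.image_univ] at hv
  funext i
  have hi : φ g i ∈ Set.range (φ g').toHom := hv ▸ Set.mem_range_self i
  obtain ⟨j, hj⟩ := hi
  rw [Copy.toHom_apply, hφ, hφ] at hj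
  have hji : j = i := by
    have h' := congrArg (fun x : Fin n => Fin.ofNat k x.val) hj
    simpa only [hcol] using h'
  subst hji
  have := congrArg Fin.val hj
  simp only [Nat.add_left_cancel_iff] at this
  exact Fin.ext (Nat.eq_of_mul_eq_mul_left hk this).symm
end SimpleGraph

/-! ### Choice of constants and the asymptotics -/

namespace SimpleGraph

open scoped Classical in
/-- Asymptotic upper bound on the number of `k`-cycles in a graph without cycles of length
`k - 2`. -/
theorem exists_copyCount_cycleGraph_le {k : ℕ} (hk : Odd k) (hk7 : 7 ≤ k) {c : ℝ} (hc : 0 < c) :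
    ∃ N : ℕ, ∀ n ≥ N, ∀ G : SimpleGraph (Fin n), (cycleGraph (k - 2)).Free G →
      (G.copyCount (cycleGraph k) : ℝ) ≤ (n / k : ℝ) ^ k + c * (n : ℝ) ^ k := by
  have : NeZero k := ⟨by omega⟩
  have hk0 : (0 : ℝ) < k := by exact_mod_cast (by omega : 0 < k)
  obtain ⟨s, hs⟩ : ∃ s, k = 2 * s + 5 := by obtain ⟨t, rfl⟩ := hk; exact ⟨t - 2, by omega⟩
  -- With `δ = c` and `ε = kc / K` the total error is `2kc n ^ k`, that is `c n ^ k` after division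
  -- by `2k`.
  set K : ℝ := k ^ 2 * (k ^ 2 + 2 * k ^ 2 / c + 1 / c ^ 2) + k with hK
  have hK0 : 0 < K := by positivity
  obtain ⟨η, hη, H⟩ := exists_trace_adjMatrix_pow_le s (show 0 < k * c / K by positivity)
  obtain ⟨N, hN⟩ := exists_nat_ge ((k : ℝ) ^ 2 / η)
  refine ⟨N + 1, fun n hn G hG => ?_⟩
  have hn0 : 0 < n := by omega
  have : Nonempty (Fin n) := ⟨⟨0, hn0⟩⟩
  have hnN : (k : ℝ) ^ 2 ≤ η * n := by
    rw [div_le_iff₀' hη] at hN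
    refine hN.trans ?_
    gcongr
    omega
  have htr : (G.adjMatrix ℝ ^ (2 * s + 3)).trace
      ≤ η * (Fintype.card (Fin n) : ℝ) ^ (2 * s + 3) := by
    rw [show k - 2 = (2 * s + 2) + 1 by omega] at hG
    refine (G.trace_adjMatrix_pow_le_of_free hG).trans ?_
    rw [Fintype.card_fin, pow_succ _ (2 * s + 2), mul_left_comm, mul_comm]
    gcongr
    refine le_trans ?_ hnN
    gcongr
    exact_mod_cast (by omega : 2 * s + 2 + 1 ≤ k)
  have hodd : ∀ l, Odd l → 3 ≤ l → l + 2 ≤ k → (G.adjMatrix ℝ ^ l).trace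
      ≤ (k * c / K) * (Fintype.card (Fin n) : ℝ) ^ l := by
    intro l hl h3 hlk
    obtain ⟨r, rfl⟩ : ∃ r, l = 2 * r + 3 := by obtain ⟨t, rfl⟩ := hl; exact ⟨t - 1, by omega⟩
    exact H (Fin n) G htr r (by omega)
  have h1 := card_cycleHoms_le hk hk7 hc (by positivity) hodd
  rw [Fintype.card_fin, ← hK, mul_div_cancel₀ _ hK0.ne'] at h1
  have h2 : (2 * k * G.copyCount (cycleGraph k) : ℝ) ≤ #(G.cycleHoms k) := by
    exact_mod_cast G.two_mul_copyCount_cycleGraph_le (by omega : 3 ≤ k)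
  have h3 := h2.trans h1
  refine le_of_mul_le_mul_left (h3.trans_eq ?_) (by positivity : (0 : ℝ) < 2 * k)
  ring

open scoped Classical in
theorem generalizedTuranNumber_cycleGraph_le {k : ℕ} (hk : Odd k) (hk7 : 7 ≤ k) {c : ℝ}
    (hc : 0 < c) : ∃ N : ℕ, ∀ n ≥ N,
      (generalizedTuranNumber n (cycleGraph k) (cycleGraph (k - 2)) : ℝ)
        ≤ (n / k : ℝ) ^ k + c * (n : ℝ) ^ k := by
  obtain ⟨N, hN⟩ := exists_copyCount_cycleGraph_le hk hk7 hc
  refine ⟨N, fun n hn => ?_⟩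
  have h0 : (0 : ℝ) ≤ (n / k : ℝ) ^ k + c * (n : ℝ) ^ k := by positivity
  rw [← Nat.le_floor_iff h0, generalizedTuranNumber, Finset.sup_le_iff]
  intro G hG
  rw [Nat.le_floor_iff h0]
  exact hN n hn G (by simpa using hG)

open scoped Classical in
theorem pow_div_le_generalizedTuranNumber {k : ℕ} (hk : Odd k) (hk5 : 5 ≤ k) (n : ℕ) :
    (n / k) ^ k ≤ generalizedTuranNumber n (cycleGraph k) (cycleGraph (k - 2)) := by
  have : NeZero k := ⟨by omega⟩
  refine (pow_div_le_copyCount_cycleBlowup k n).trans ?_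
  refine Finset.le_sup (f := fun G : SimpleGraph (Fin n) => G.copyCount (cycleGraph k)) ?_
  rw [Finset.mem_filter]
  exact ⟨Finset.mem_univ _, cycleGraph_free_cycleBlowup (Nat.Odd.sub_even (by omega) hk even_two)
    (by omega) (by omega)⟩

/-- Rounding down in the balanced blow-up is asymptotically negligible. -/
theorem _root_.Nat.div_pow_sub_le_floor_pow {k n : ℕ} (hk : 0 < k) {c : ℝ}
    (hn : (k : ℝ) ^ 2 ≤ c * n) (hkn : k ≤ n) :
    (n / k : ℝ) ^ k - c * (n : ℝ) ^ k ≤ (((n / k : ℕ)) : ℝ) ^ k := by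
  have hk1 : (1 : ℝ) ≤ k := by exact_mod_cast hk
  have hn0 : (0 : ℝ) < n := by exact_mod_cast (by omega : 0 < n)
  have hkn' : (k : ℝ) ≤ n := by exact_mod_cast hkn
  have h1 : (n / k : ℝ) - 1 ≤ ((n / k : ℕ) : ℝ) := by
    rw [← Nat.floor_div_eq_div (K := ℝ)]
    exact (Nat.sub_one_lt_floor _).le
  have h2 : (n / k : ℝ) - 1 = (n / k) * (1 + -(k / n)) := by field_simp; ring
  have h3 : (k : ℝ) / n ≤ 1 := by rw [div_le_one hn0]; exact hkn'
  -- Bernoulli's inequality: rounding down costs a relative error of at most `k ^ 2 / n ≤ c`.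
  have h4 := one_add_mul_le_pow (show (-2 : ℝ) ≤ -(k / n) by linarith) k
  have h5 : (k : ℝ) * (k / n) ≤ c := by
    rw [← mul_div_assoc, div_le_iff₀ hn0, ← sq]; exact hn
  have h6 : (n / k : ℝ) ^ k ≤ (n : ℝ) ^ k := by
    gcongr
    exact div_le_self hn0.le hk1
  have h7 : (0 : ℝ) ≤ (n / k : ℝ) ^ k := by positivity
  have hc : 0 ≤ c := le_trans (by positivity) h5
  calc (n / k : ℝ) ^ k - c * (n : ℝ) ^ k ≤ (n / k : ℝ) ^ k - c * (n / k : ℝ) ^ k := by gcongr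
    _ ≤ (n / k : ℝ) ^ k * (1 + k * -(k / n)) := by nlinarith
    _ ≤ (n / k : ℝ) ^ k * (1 + -(k / n)) ^ k := by gcongr
    _ = ((n / k : ℝ) - 1) ^ k := by rw [h2, mul_pow]
    _ ≤ _ := by
        gcongr
        rw [sub_nonneg, one_le_div (by linarith)]
        exact hkn'
end SimpleGraph

end

theorem mainTheorem2 (k : ℕ) (hk : Odd k) (hk7 : 7 ≤ k) :
    Asymptotics.IsLittleO Filter.atTop
      (fun n : ℕ =>
        (SimpleGraph.generalizedTuranNumber n
          (SimpleGraph.cycleGraph k) (SimpleGraph.cycleGraph (k - 2)) : ℝ)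
          - ((n : ℝ) / (k : ℝ)) ^ k)
      (fun n : ℕ => (n : ℝ) ^ k) := by
  rw [Asymptotics.isLittleO_iff]
  intro c hc
  obtain ⟨N, hN⟩ := SimpleGraph.generalizedTuranNumber_cycleGraph_le hk hk7 hc
  obtain ⟨M, hM⟩ := exists_nat_ge ((k : ℝ) ^ 2 / c)
  filter_upwards [Filter.eventually_ge_atTop (max N (max M k))] with n hn
  simp only [max_le_iff] at hn
  have h1 := hN n hn.1
  have h2 : (((n / k : ℕ)) : ℝ) ^ k ≤ (SimpleGraph.generalizedTuranNumber n
      (SimpleGraph.cycleGraph k) (SimpleGraph.cycleGraph (k - 2)) : ℝ) := by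
    exact_mod_cast SimpleGraph.pow_div_le_generalizedTuranNumber hk (by omega) n
  have h3 : (k : ℝ) ^ 2 ≤ c * n := by
    rw [div_le_iff₀' hc] at hM
    refine hM.trans ?_
    gcongr
    exact hn.2.1
  have h4 := Nat.div_pow_sub_le_floor_pow (by omega) h3 hn.2.2
  rw [Real.norm_eq_abs, Real.norm_of_nonneg (by positivity), abs_le]
  constructor <;> linarith
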